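/- All graphs are finite, simple and undirected. A set $S\subseteq V(G)$ is an independent cutset of $G$ if it is an independent set and $G-S$ is disconnected (the graph with no vertices is not disconnected). A tree decomposition of $G$ is a pair $(T,\{X_t\}_{t\in V(T)})$, where $T$ is a tree and the bags $X_t\subseteq V(G)$ satisfy: every vertex of $G$ lies in some bag, both ends of every edge lie in a common bag, and for each $v\in V(G)$ the set $\{t : v\in X_t\}$ induces a connected subtree of $T$. With $T$ rooted at a node $r$, a leaf is a node of degree $1$ other than $r$. The decomposition is nice if $X_r=\emptyset$, $X_t=\emptyset$ for every leaf $t$, and every node $t$ that is not a leaf is of one of the following types: an introduce node (exactly one child $t'$, and $X_t=X_{t'}\cup\{v\}$ for some $v\notin X_{t'}$), a forget node (exactly one child $t'$, and $X_t=X_{t'}\setminus\{w\}$ for some $w\in X_{t'}$), or a join node (exactly two children $t',t''$, and $X_t=X_{t'}=X_{t''}$). An $\ell$-refined tree decomposition $(T,\{(X_t,U_t)\}_{t\in V(T)})$ is a tree decomposition $(T,\{X_t\})$ together with sets $U_t\subseteq X_t$ with $|U_t|\le\ell$ for all $t$; it is nice if $(T,\{X_t\})$ is. Its residual independence number is $\max_{t}\alpha(G[X_t\setminus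 U_t])$, where $\alpha$ is the independence number. **Theorem.** There are an algorithm and a polynomial $p$ with the following property. Let $\ell,k\ge 0$ be integers, let $G$ be a connected graph with $n\ge 1$ vertices, and let $\widehat{\mathcal T}=(T,\{(X_t,U_t)\}_{t\in V(T)})$ be a nice $\ell$-refined tree decomposition of $G$ with root $r$ and residual independence number at most $k$. Given $G$ and $\widehat{\mathcal T}$ (with its root), the algorithm correctly decides whether $G$ has an independent cutset, in time at most $$p\bigl(n+|V(T)|\bigr)\cdot 3^{\ell}\,(2n)^{k}.$$ That is, Independent Cutset with $\widehat{\mathcal T}$ as an additional input can be decided in $\mathcal O^*(3^\ell(2n)^k)$ time, where $\mathcal O^*$ suppresses factors polynomial in the size of the input. Here time is the number of elementary operations of a fixed program in a first-order recursive language on binary trees, in which reading a variable, creating a cell, inspecting a cell, binding a variable and calling a function cost one unit each; graphs and set families are given by their $0$-$1$-matrices, and the root by a unary number. -/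

import Mathlib

namespace IndCut

section Graphs

variable {V ι : Type*}

/-- `S` is an independent cutset of `G`: it is an independent set and `G - S` is disconnected, i.e.
some two vertices of `G - S` are not joined by a walk in `G - S`. (The graph without vertices is not
disconnected.) -/
def IsIndependentCutset (G : SimpleGraph V) (S : Set V) : Prop :=
  G.IsIndepSet S ∧ ¬ (G.induce Sᶜ).Preconnected

/-- `G` is a yes-instance of the problem Independent Cutset. -/
def HasIndependentCutset (G : SimpleGraph V) : Prop :=
  ∃ S : Set V, IsIndependentCutset G S

/-- `(T, X)` is a tree decomposition of `G`. -/
structure IsTreeDecomposition (G : SimpleGraph V) (T : SimpleGraph ι) (X : ι → Finset V) :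
    Prop where
  isTree : T.IsTree
  vertex_mem : ∀ v, ∃ t, v ∈ X t
  edge_mem : ∀ u v, G.Adj u v → ∃ t, u ∈ X t ∧ v ∈ X t
  subtree : ∀ v, (T.induce {t | v ∈ X t}).Connected

/-- The children of the node `t` in the tree `T` rooted at `r`: the neighbours of `t` that are
farther from the root. -/
def children (T : SimpleGraph ι) (r t : ι) : Set ι :=
  {t' | T.Adj t t' ∧ T.dist r t' = T.dist r t + 1}

/-- A leaf of a rooted tree: a node of degree 1 that is not the root. -/
def IsLeaf (T : SimpleGraph ι) (r t : ι) : Prop :=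
  t ≠ r ∧ (T.neighborSet t).ncard = 1

def IsIntroduceNode [DecidableEq V] (T : SimpleGraph ι) (r : ι) (X : ι → Finset V) (t : ι) :
    Prop :=
  ∃ t', children T r t = {t'} ∧ ∃ v, v ∉ X t' ∧ X t = insert v (X t')

def IsForgetNode [DecidableEq V] (T : SimpleGraph ι) (r : ι) (X : ι → Finset V) (t : ι) : Prop :=
  ∃ t', children T r t = {t'} ∧ ∃ w, w ∈ X t' ∧ X t = (X t').erase w

def IsJoinNode (T : SimpleGraph ι) (r : ι) (X : ι → Finset V) (t : ι) : Prop :=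
  ∃ t' t'', t' ≠ t'' ∧ children T r t = {t', t''} ∧ X t = X t' ∧ X t = X t''

/-- The tree decomposition `(T, X)` with root `r` is nice. -/
structure IsNice [DecidableEq V] (T : SimpleGraph ι) (r : ι) (X : ι → Finset V) : Prop where
  root : X r = ∅
  leaf : ∀ t, IsLeaf T r t → X t = ∅
  node : ∀ t, IsLeaf T r t ∨ IsIntroduceNode T r X t ∨ IsForgetNode T r X t ∨ IsJoinNode T r X t

/-- `(T, (X, U))` is an `l`-refined tree decomposition of `G`. -/
structure IsRefinedTreeDecomposition (G : SimpleGraph V) (T : SimpleGraph ι) (X U : ι → Finset V)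
    (l : ℕ) : Prop where
  treeDecomposition : IsTreeDecomposition G T X
  subset : ∀ t, U t ⊆ X t
  card_le : ∀ t, (U t).card ≤ l

/-- The residual independence number, the maximum over all nodes `t` of the independence number of
`G[X t \ U t]`. -/
noncomputable def residualIndepNum [DecidableEq V] [Fintype ι] (G : SimpleGraph V)
    (X U : ι → Finset V) : ℕ :=
  Finset.univ.sup fun t => (G.induce (↑(X t \ U t) : Set V)).indepNum

end Graphs

/-! ### The model of computation

A first-order functional (LISP-like) language with recursion, whose data are binary trees. An
elementary operation either reads a variable, creates one new cell, inspects one cell, or passes one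
argument to a function, and is charged one time unit; trees are handled by reference, so each
operation takes constant time on a pointer machine. There are no operations on whole trees
(in particular no equality test), and there is no arithmetic. -/

/-- Binary trees built from an atom `nil` by pairing. -/
inductive Data : Type
  | nil : Data
  | cons : Data → Data → Data

/-- Expressions. Variables are de Bruijn indices into the current environment. -/
inductive Exp : Type
  /-- the `i`-th variable -/
  | var : ℕ → Exp
  /-- the atom -/
  | nil : Exp
  /-- make a new cell -/
  | cons : Exp → Exp → Exp
  /-- `case e a b`: if `e` is `nil` go on with `a`, else with `b`, in which the variables 0 and 1
  are bound to the two components of `e` -/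
  | case : Exp → Exp → Exp → Exp
  /-- bind the variable 0 to the value of the first expression in the second one -/
  | bind : Exp → Exp → Exp
  /-- call the `f`-th function of the program -/
  | call : ℕ → Exp → Exp

/-- A program is a finite list of (mutually recursive, one-argument) functions, given by their
bodies, in which the variable 0 is the argument. The function number 0 is the main function. -/
abbrev Program : Type := List Exp

/-- `Eval P env e v s`: in the program `P`, and with the environment `env`, the evaluation of the
expression `e` terminates with value `v` after exactly `s` elementary operations. -/
inductive Eval (P : Program) : List Data → Exp → Data → ℕ → Prop
  | var {env : List Data} {i : ℕ} {v : Data} :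
      env[i]? = some v → Eval P env (.var i) v 1
  | nil {env : List Data} : Eval P env .nil .nil 1
  | cons {env : List Data} {a b : Exp} {x y : Data} {s t : ℕ} :
      Eval P env a x s → Eval P env b y t → Eval P env (.cons a b) (.cons x y) (s + t + 1)
  | case_nil {env : List Data} {e a b : Exp} {v : Data} {s t : ℕ} :
      Eval P env e .nil s → Eval P env a v t → Eval P env (.case e a b) v (s + t + 1)
  | case_cons {env : List Data} {e a b : Exp} {x y v : Data} {s t : ℕ} :
      Eval P env e (.cons x y) s → Eval P (x :: y :: env) b v t →
      Eval P env (.case e a b) v (s + t + 1)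
  | bind {env : List Data} {e b : Exp} {x v : Data} {s t : ℕ} :
      Eval P env e x s → Eval P (x :: env) b v t → Eval P env (.bind e b) v (s + t + 1)
  | call {env : List Data} {f : ℕ} {e body : Exp} {x v : Data} {s t : ℕ} :
      Eval P env e x s → P[f]? = some body → Eval P [x] body v t →
      Eval P env (.call f e) v (s + t + 1)

/-- Value and running time are determined by the program and its input. -/
theorem Eval.deterministic {P : Program} {env : List Data} {e : Exp} {v w : Data} {s t : ℕ}
    (h : Eval P env e v s) (h' : Eval P env e w t) : v = w ∧ s = t := by
  induction h generalizing w t with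
  | var h1 => cases h' with | var h2 => simp_all
  | nil => cases h'; simp
  | cons _ _ ih1 ih2 =>
    cases h' with | cons h3 h4 => have := ih1 h3; have := ih2 h4; simp_all
  | case_nil _ _ ih1 ih2 =>
    cases h' with
    | case_nil h3 h4 => have := ih1 h3; have := ih2 h4; simp_all
    | case_cons h3 h4 => have := ih1 h3; simp_all
  | case_cons _ _ ih1 ih2 =>
    cases h' with
    | case_nil h3 h4 => have := ih1 h3; simp_all
    | case_cons h3 h4 =>
      have h5 := ih1 h3
      simp only [Data.cons.injEq] at h5
      obtain ⟨⟨rfl, rfl⟩, rfl⟩ := h5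
      have := ih2 h4; simp_all
  | bind _ _ ih1 ih2 =>
    cases h' with
    | bind h3 h4 =>
      obtain ⟨rfl, rfl⟩ := ih1 h3
      have := ih2 h4; simp_all
  | call _ hb _ ih1 ih2 =>
    cases h' with
    | call h3 h6 h4 =>
      obtain ⟨rfl, rfl⟩ := ih1 h3
      rw [hb] at h6
      cases h6
      have := ih2 h4; simp_all

/-- The main function of `P` on the argument `input` returns `output` after `s` elementary
operations. -/
def Program.Returns (P : Program) (input output : Data) (s : ℕ) : Prop :=
  ∃ body, P[0]? = some body ∧ Eval P [input] body output s

/-! ### Encoding of the input -/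

/-- A list, as a chain of cells. -/
def Data.ofList : List Data → Data
  | [] => .nil
  | x :: xs => .cons x (ofList xs)

/-- A natural number in unary. -/
def Data.ofNat (n : ℕ) : Data := ofList (List.replicate n .nil)

open Classical in
/-- A truth value. -/
noncomputable def Data.ofProp (p : Prop) : Data := if p then .cons .nil .nil else .nil

/-- A relation, as the list of the rows of its 0-1-matrix. -/
noncomputable def Data.ofRel {a b : ℕ} (R : Fin a → Fin b → Prop) : Data :=
  ofList ((List.finRange a).map fun i => ofList ((List.finRange b).map fun j => ofProp (R i j)))

/-- A graph `G` on `{0, …, n - 1}`, by its adjacency matrix, together with a family of pairs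
`(X t, U t)` of vertex sets indexed by the nodes of a graph `T` on `{0, …, N - 1}` with root `r`. -/
noncomputable def encodeInput {n N : ℕ} (G : SimpleGraph (Fin n)) (T : SimpleGraph (Fin N))
    (r : Fin N) (X U : Fin N → Finset (Fin n)) : Data :=
  Data.ofList
    [Data.ofRel G.Adj, Data.ofRel T.Adj, Data.ofNat r, Data.ofRel fun t v => v ∈ X t,
      Data.ofRel fun t v => v ∈ U t]

end IndCut

/-!
An independent cutset of `G` is the same as a colouring of the vertices with the colours `s`, `a`,
`b` in which no edge joins two vertices of colour `s`, or a vertex of colour `a` to one of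
colour `b`, and in which both `a` and `b` occur (`hasIndependentCutset_iff`). The program tries all pairs
`(i, j)` of vertices and looks for such a colouring with `i` in `a` and `j` in `b`. This is a
constraint satisfaction problem whose constraints lie within the bags of the tree decomposition, and
it is solved by arc consistency. The table of a node initially holds all proper colourings of its
bag with the prescribed colours (`mem_gen`). In each of `|V(T)|` rounds, a colouring is deleted from the
table of `t` unless every neighbour `c` of `t` has a colouring in its table that agrees with it on
the common vertices (`mem_tables_succ`). The restrictions of a global solution are never deleted.
Conversely, a colouring that is left at one node after as many rounds as the tree is high yields
colourings of all bags that agree along the tree edges, chosen by increasing distance from that node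
(`exists_consistent`). As the bags that contain a given vertex form a subtree, these glue to a
global solution (`IsTreeDecomposition.exists_glue`). Only the tree decomposition itself matters for
this; the root of the tree and the sets `U t` are not consulted.

A partial colouring of a bag `X t` is determined by its restriction to `U t`, by the independent set
of the vertices of `X t \ U t` with colour `s`, which has at most `k` elements, and by the
colours of the components of the rest of `X t \ U t`, of which there are at most `k` since
representatives are independent. So a table has at most `(n + 1) * 3 ^ l * (2 * n) ^ k` entries
(`card_isPartialColoring_le`), and the same holds for the intermediate lists when it is generated
vertex by vertex, which are tables of subsets of the bag. Two tables have to be compared in nearly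
linear rather than quadratic time. For this, the colourings in one of them, restricted to the common
vertices, are stored as words in a trie, in which those of the other one are looked up.

Running times are established by symbolic execution: `Wp P env e Q` says that `e` terminates with a
value and a time that satisfy `Q`, and its simplification rules, one for each kind of expression,
reduce the statement that a function runs in a given time to the recursive calls and an inequality.
-/

namespace IndCut

/-! ### A symbolic-execution calculus for programs -/

/-- First component of a cell, and `nil` for the atom. -/
def Data.fst : Data → Data
  | .nil => .nil
  | .cons x _ => x

/-- Second component of a cell, and `nil` for the atom. -/
def Data.snd : Data → Data
  | .nil => .nil
  | .cons _ y => y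

/-- The `i`-th entry of a list of data. -/
def Data.nth : ℕ → Data → Data
  | 0, d => d.fst
  | i + 1, d => Data.nth i d.snd

@[simp] theorem Data.fst_nil : Data.fst .nil = .nil := rfl
@[simp] theorem Data.snd_nil : Data.snd .nil = .nil := rfl
@[simp] theorem Data.fst_cons (x y : Data) : Data.fst (.cons x y) = x := rfl
@[simp] theorem Data.snd_cons (x y : Data) : Data.snd (.cons x y) = y := rfl
@[simp] theorem Data.nth_zero_cons (x y : Data) : Data.nth 0 (.cons x y) = x := rfl
@[simp] theorem Data.nth_succ_cons (i : ℕ) (x y : Data) :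
    Data.nth (i + 1) (.cons x y) = Data.nth i y := rfl

namespace Exp

/-- The truth value `true`. -/
def tt : Exp := .cons .nil .nil

/-- The first component of the value of `e`, `nil` if the value is `nil`. -/
def fst (e : Exp) : Exp := .case e .nil (.var 0)

/-- The second component of the value of `e`, `nil` if the value is `nil`. -/
def snd (e : Exp) : Exp := .case e .nil (.var 1)

/-- The result of taking the second component `i` times. -/
def drop : ℕ → Exp → Exp
  | 0, e => e
  | i + 1, e => drop i (snd e)

/-- The `i`-th entry of the list stored in the variable `d`. -/
def arg (d i : ℕ) : Exp := fst (drop i (.var d))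

/-- The list of the values of the given expressions. -/
def tup : List Exp → Exp
  | [] => .nil
  | e :: es => .cons e (tup es)

end Exp

/-- The evaluation of `e` terminates, with a value and a running time that satisfy `Q`. -/
def Wp (P : Program) (env : List Data) (e : Exp) (Q : Data → ℕ → Prop) : Prop :=
  ∃ v s, Eval P env e v s ∧ Q v s

/-- The `f`-th function of `P` maps `x` to `v` after exactly `s` operations. -/
def Fn (P : Program) (f : ℕ) (x v : Data) (s : ℕ) : Prop :=
  ∃ body, P[f]? = some body ∧ Eval P [x] body v s

/-- The `f`-th function of `P` maps `x` to `v` after at most `b` operations. -/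
def Runs (P : Program) (f : ℕ) (x v : Data) (b : ℕ) : Prop :=
  ∃ s ≤ b, Fn P f x v s

section Rules

variable {P : Program} {env : List Data} {Q : Data → ℕ → Prop}

@[simp] theorem wp_var {i : ℕ} : Wp P env (.var i) Q ↔ ∃ v, env[i]? = some v ∧ Q v 1 := by
  constructor
  · rintro ⟨v, s, h, hQ⟩
    cases h with | var h => exact ⟨v, h, hQ⟩
  · rintro ⟨v, h, hQ⟩
    exact ⟨v, 1, .var h, hQ⟩

@[simp] theorem wp_nil : Wp P env .nil Q ↔ Q .nil 1 := by
  constructor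
  · rintro ⟨v, s, h, hQ⟩
    cases h with | nil => exact hQ
  · exact fun hQ => ⟨_, _, .nil, hQ⟩

@[simp] theorem wp_cons {a b : Exp} : Wp P env (.cons a b) Q ↔
    Wp P env a fun x s => Wp P env b fun y t => Q (.cons x y) (s + t + 1) := by
  constructor
  · rintro ⟨v, s, h, hQ⟩
    cases h with | cons ha hb => exact ⟨_, _, ha, _, _, hb, hQ⟩
  · rintro ⟨x, s, ha, y, t, hb, hQ⟩
    exact ⟨_, _, .cons ha hb, hQ⟩

@[simp] theorem wp_bind {a b : Exp} : Wp P env (.bind a b) Q ↔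
    Wp P env a fun x s => Wp P (x :: env) b fun y t => Q y (s + t + 1) := by
  constructor
  · rintro ⟨v, s, h, hQ⟩
    cases h with | bind ha hb => exact ⟨_, _, ha, _, _, hb, hQ⟩
  · rintro ⟨x, s, ha, y, t, hb, hQ⟩
    exact ⟨_, _, .bind ha hb, hQ⟩

/-- The condition under which a case distinction on the value `x`, obtained after `s` operations,
goes on to satisfy `Q`. -/
def CaseWp (P : Program) (env : List Data) (a b : Exp) (Q : Data → ℕ → Prop) :
    Data → ℕ → Prop
  | .nil, s => Wp P env a fun v t => Q v (s + t + 1)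
  | .cons x y, s => Wp P (x :: y :: env) b fun v t => Q v (s + t + 1)

@[simp] theorem caseWp_nil {a b : Exp} {s : ℕ} : CaseWp P env a b Q .nil s ↔
    Wp P env a fun v t => Q v (s + t + 1) := Iff.rfl

@[simp] theorem caseWp_cons {a b : Exp} {x y : Data} {s : ℕ} :
    CaseWp P env a b Q (.cons x y) s ↔
      Wp P (x :: y :: env) b fun v t => Q v (s + t + 1) := Iff.rfl

@[simp] theorem wp_case {e a b : Exp} :
    Wp P env (.case e a b) Q ↔ Wp P env e (CaseWp P env a b Q) := by
  constructor
  · rintro ⟨v, s, h, hQ⟩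
    cases h with
    | case_nil he ha => exact ⟨_, _, he, _, _, ha, hQ⟩
    | case_cons he ha => exact ⟨_, _, he, _, _, ha, hQ⟩
  · rintro ⟨x, s, he, h⟩
    cases x with
    | nil =>
      obtain ⟨v, t, ha, hQ⟩ := h
      exact ⟨_, _, .case_nil he ha, hQ⟩
    | cons x y =>
      obtain ⟨v, t, ha, hQ⟩ := h
      exact ⟨_, _, .case_cons he ha, hQ⟩

@[simp] theorem wp_call {f : ℕ} {e : Exp} : Wp P env (.call f e) Q ↔
    Wp P env e fun x s => ∃ v t, Fn P f x v t ∧ Q v (s + t + 1) := by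
  constructor
  · rintro ⟨v, s, h, hQ⟩
    cases h with | call he hf hb => exact ⟨_, _, he, _, _, ⟨_, hf, hb⟩, hQ⟩
  · rintro ⟨x, s, he, v, t, ⟨body, hf, hb⟩, hQ⟩
    exact ⟨_, _, .call he hf hb, hQ⟩

@[simp] theorem wp_fst {e : Exp} :
    Wp P env e.fst Q ↔ Wp P env e fun v s => Q v.fst (s + 2) := by
  rw [Exp.fst, wp_case]
  unfold Wp
  refine exists_congr fun v => exists_congr fun s => and_congr_right fun _ => ?_
  cases v <;> simp

@[simp] theorem wp_snd {e : Exp} :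
    Wp P env e.snd Q ↔ Wp P env e fun v s => Q v.snd (s + 2) := by
  rw [Exp.snd, wp_case]
  unfold Wp
  refine exists_congr fun v => exists_congr fun s => and_congr_right fun _ => ?_
  cases v <;> simp

theorem wp_fst_drop {i : ℕ} {e : Exp} :
    Wp P env (Exp.fst (Exp.drop i e)) Q ↔
      Wp P env e fun v s => Q (v.nth i) (s + 2 * i + 2) := by
  induction i generalizing e with
  | zero => simp [Exp.drop, Data.nth]
  | succ i ih =>
    simp only [Exp.drop, ih, wp_snd, Data.nth]
    have (s : ℕ) : s + 2 + 2 * i + 2 = s + 2 * (i + 1) + 2 := by ring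
    simp only [this]

@[simp] theorem wp_arg {d i : ℕ} : Wp P env (Exp.arg d i) Q ↔
    ∃ v, env[d]? = some v ∧ Q (v.nth i) (2 * i + 3) := by
  simp only [Exp.arg, wp_fst_drop, wp_var]
  have : 1 + 2 * i + 2 = 2 * i + 3 := by ring
  simp only [this]

@[simp] theorem wp_tt : Wp P env Exp.tt Q ↔ Q (.cons .nil .nil) 3 := by
  simp [Exp.tt]

@[simp] theorem wp_tup_nil : Wp P env (Exp.tup []) Q ↔ Q .nil 1 := by
  simp [Exp.tup]

@[simp] theorem wp_tup_cons {e : Exp} {es : List Exp} : Wp P env (Exp.tup (e :: es)) Q ↔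
    Wp P env e fun x s => Wp P env (Exp.tup es) fun y t => Q (.cons x y) (s + t + 1) := by
  simp [Exp.tup]

theorem Runs.intro {f : ℕ} {body : Exp} {x v : Data} {b : ℕ} (hf : P[f]? = some body)
    (h : Wp P [x] body fun v' s => v' = v ∧ s ≤ b) : Runs P f x v b := by
  obtain ⟨_, s, h, rfl, hs⟩ := h
  exact ⟨s, hs, body, hf, h⟩

end Rules

/-! ### Colours, words and their encoding -/

/-- The colours: `s` for the vertices of the cutset, `a` and `b` for its two sides. -/
inductive Col : Type
  | s | a | b
  deriving DecidableEq

/-- The encoding of a colour. -/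
def Col.enc : Col → Data
  | .s => .nil
  | .a => .cons .nil .nil
  | .b => .cons (.cons .nil .nil) .nil

/-- The encoding of a truth value. -/
def encBool (b : Bool) : Data := if b then .cons .nil .nil else .nil

/-- The encoding of a list with a given encoding of its entries. -/
def encList {α : Type*} (e : α → Data) (l : List α) : Data := Data.ofList (l.map e)

@[simp] theorem Col.enc_s : Col.enc .s = .nil := rfl
@[simp] theorem Col.enc_a : Col.enc .a = .cons .nil .nil := rfl
@[simp] theorem Col.enc_b : Col.enc .b = .cons (.cons .nil .nil) .nil := rfl
@[simp] theorem encBool_true : encBool true = .cons .nil .nil := rfl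
@[simp] theorem encBool_false : encBool false = .nil := rfl
@[simp] theorem encList_nil {α : Type*} (e : α → Data) : encList e [] = .nil := rfl
@[simp] theorem encList_cons {α : Type*} (e : α → Data) (x : α) (l : List α) :
    encList e (x :: l) = .cons (e x) (encList e l) := rfl
@[simp] theorem ofList_nil : Data.ofList [] = .nil := rfl
@[simp] theorem ofList_cons (x : Data) (l : List Data) :
    Data.ofList (x :: l) = .cons x (Data.ofList l) := rfl

/-- The first entry of a list of bits, `false` if there is none. -/
def hd (l : List Bool) : Bool := l.getD 0 false

/-- The first row of a bit matrix, empty if there is none. -/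
def hdRow (l : List (List Bool)) : List Bool := l.getD 0 []

@[simp] theorem hd_nil : hd [] = false := rfl
@[simp] theorem hd_cons (x : Bool) (l : List Bool) : hd (x :: l) = x := rfl
@[simp] theorem hdRow_nil : hdRow [] = [] := rfl
@[simp] theorem hdRow_cons (x : List Bool) (l : List (List Bool)) : hdRow (x :: l) = x := rfl

/-- A bit vector. -/
abbrev encBits : List Bool → Data := encList encBool
/-- A bit matrix. -/
abbrev encRows : List (List Bool) → Data := encList encBits
/-- A word of colours. -/
abbrev encWord : List Col → Data := encList Col.enc
/-- A list of words. -/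
abbrev encWords : List (List Col) → Data := encList encWord
/-- A list of lists of words. -/
abbrev encTabs : List (List (List Col)) → Data := encList encWords

@[simp] theorem fst_encBits (l : List Bool) : (encBits l).fst = encBool (hd l) := by
  cases l <;> rfl
@[simp] theorem fst_encRows (l : List (List Bool)) : (encRows l).fst = encBits (hdRow l) := by
  cases l <;> rfl
@[simp] theorem snd_encList {α : Type*} (e : α → Data) (l : List α) :
    (encList e l).snd = encList e l.tail := by
  cases l <;> rfl

/-! ### The program -/

/-- Membership of the word `w` in the set of words stored in the trie `t`. -/
def lookup : List Col → Data → Bool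
  | [], .nil => false
  | [], .cons _ _ => true
  | .s :: w, t => lookup w t.fst
  | .a :: w, t => lookup w t.snd.fst
  | .b :: w, t => lookup w t.snd.snd

/-- Insertion of a word into a trie. -/
def ins : List Col → Data → Data
  | [], _ => .cons .nil .nil
  | .s :: w, t => .cons (ins w t.fst) t.snd
  | .a :: w, t => .cons t.fst (.cons (ins w t.snd.fst) t.snd.snd)
  | .b :: w, t => .cons t.fst (.cons t.snd.fst (ins w t.snd.snd))

/-- The word `w`, with the colour `s` put wherever one of the bits of `x` and `y` is not set. -/
def mask : List Col → List Bool → List Bool → List Col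
  | [], _, _ => []
  | c :: w, x, y => (if hd x then if hd y then c else .s else .s) :: mask w x.tail y.tail

/-- The trie of the masked words. -/
def build (x y : List Bool) : List (List Col) → Data
  | [] => .nil
  | w :: L => ins (mask w x y) (build x y L)

/-- The words that, when masked, belong to the trie `t`. -/
def filt (x y : List Bool) (t : Data) : List (List Col) → List (List Col)
  | [] => []
  | w :: L => if lookup (mask w x y) t then w :: filt x y t L else filt x y t L

/-- The words of `L` that are consistent with the tables of all neighbours. -/
def revise (x : List Bool) :
    List (List Col) → List Bool → List (List (List Col)) → List (List Bool) → List (List Col)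
  | L, _, [], _ => L
  | L, adj, L' :: tabs, xs =>
    revise x (if hd adj then filt x (hdRow xs) (build x (hdRow xs) L') L else L) adj.tail tabs
      xs.tail

/-- One round of revisions: the rows `todoX` and `todoT` belong to the tables `todo`. -/
def sweep (tabs : List (List (List Col))) (X : List (List Bool)) :
    List (List (List Col)) → List (List Bool) → List (List Bool) → List (List (List Col))
  | [], _, _ => []
  | L :: todo, todoX, todoT =>
    revise (hdRow todoX) L (hdRow todoT) tabs X :: sweep tabs X todo todoX.tail todoT.tail

/-- As many rounds as the first argument has entries. -/
def iter (X T : List (List Bool)) :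
    List (List Bool) → List (List (List Col)) → List (List (List Col))
  | [], tabs => tabs
  | _ :: cnt, tabs => iter X T cnt (sweep tabs X tabs X T)

/-- Whether the colours `c` and `d` are forbidden for adjacent vertices. -/
def conflict : Col → Col → Bool
  | .s, .s => true
  | .a, .b => true
  | .b, .a => true
  | _, _ => false

/-- Whether a vertex whose neighbours are given by `row` can get the colour `c` when the vertices in
`x` are coloured by `w`. Vertices outside `x` have the letter `s` in `w`, which must not count as a
colour here. -/
def check (c : Col) : List Col → List Bool → List Bool → Bool
  | [], _, _ => true
  | d :: w, row, x =>
    if hd row then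
      if hd x then if conflict c d then false else check c w row.tail x.tail
      else check c w row.tail x.tail
    else check c w row.tail x.tail

/-- The words of `L` extended by the colour `c`, where this is possible, followed by `acc`. -/
def ext (c : Col) (row x : List Bool) (acc : List (List Col)) : List (List Col) → List (List Col)
  | [] => acc
  | w :: L => if check c w row x then (c :: w) :: ext c row x acc L else ext c row x acc L

/-- The words for the colourings of the vertices in `x` of the graph with the matrix `M` in which no
edge is in conflict, the vertices of `a` have the colour `a` and those of `b` the colour `b`. The
recursion removes the first vertex, hence the first row and the first column of `M`. -/
def gen : List Bool → List (List Bool) → List Bool → List Bool → List (List Col)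
  | [], _, _, _ => [[]]
  | i :: x, M, a, b =>
    let L := gen x (M.tail.map List.tail) a.tail b.tail
    let row := (hdRow M).tail
    if i then
      if hd a then if hd b then [] else ext .a row x [] L
      else if hd b then ext .b row x [] L
      else ext .s row x (ext .a row x (ext .b row x [] L) L) L
    else ext .s [] [] [] L

/-- The search for the second vertex of a pair whose first vertex is given by `a`. The candidates
are the bit vectors obtained from `b` by adding fewer zeros in front than the counter has entries; with
`b = [true]` these are the singletons. A candidate is accepted if the first table is nonempty after
the rounds counted by `T`. -/
def loopB (a : List Bool) (G T X : List (List Bool)) : List (List Bool) → List Bool → Bool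
  | [], _ => false
  | _ :: cnt, b =>
    match iter X T T (X.map fun x => gen x G a b) with
    | (_ :: _) :: _ => true
    | _ => loopB a G T X cnt (false :: b)

/-- The search for two vertices that can be separated; the candidates for the first one are obtained
from `a` as in `loopB`. -/
def loopA (G T X : List (List Bool)) : List (List Bool) → List Bool → Bool
  | [], _ => false
  | _ :: cnt, a => if loopB a G T X G [true] then true else loopA G T X cnt (false :: a)

open Exp in
/-- The program. Every function gets the list of its arguments, so that `arg d i` is its `i`-th
argument where the variable `d` holds that list. The branch for a nonempty list `arg 0 0` begins
with its head in the variable 0, its tail in the variable 1 and the arguments in the variable 2; each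
further case distinction shifts these by two, each `bind` by one. -/
def prog : Program :=
  [ -- 0: the main function
    call 14 (tup [arg 0 0, tup [tt], arg 0 0, arg 0 1, arg 0 3]),
    -- 1: `lookup`, of a word and a trie
    case (arg 0 0) (case (arg 0 1) nil tt)
      (case (var 0) (call 1 (tup [var 1, fst (arg 2 1)]))
        (case (var 0) (call 1 (tup [var 3, fst (snd (arg 4 1))]))
          (call 1 (tup [var 5, snd (snd (arg 6 1))])))),
    -- 2: `ins`, of a word and a trie
    case (arg 0 0) tt
      (case (var 0) (cons (call 2 (tup [var 1, fst (arg 2 1)])) (snd (arg 2 1)))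
        (case (var 0)
          (cons (fst (arg 4 1))
            (cons (call 2 (tup [var 3, fst (snd (arg 4 1))])) (snd (snd (arg 4 1)))))
          (cons (fst (arg 6 1))
            (cons (fst (snd (arg 6 1))) (call 2 (tup [var 5, snd (snd (arg 6 1))])))))),
    -- 3: `mask`, of a word and two bit vectors
    case (arg 0 0) nil
      (cons (case (fst (arg 2 1)) nil (case (fst (arg 4 2)) nil (var 4)))
        (call 3 (tup [var 1, snd (arg 2 1), snd (arg 2 2)]))),
    -- 4: `build`, of a list of words and two bit vectors
    case (arg 0 0) nil
      (call 2 (tup [call 3 (tup [var 0, arg 2 1, arg 2 2]),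
        call 4 (tup [var 1, arg 2 1, arg 2 2])])),
    -- 5: `filt`, of a list of words, two bit vectors and a trie
    case (arg 0 0) nil
      (case (call 1 (tup [call 3 (tup [var 0, arg 2 1, arg 2 2]), arg 2 3]))
        (call 5 (tup [var 1, arg 2 1, arg 2 2, arg 2 3]))
        (cons (var 2) (call 5 (tup [var 3, arg 4 1, arg 4 2, arg 4 3])))),
    -- 6: `revise`, of the tables of the others, a table, its row, adjacencies, other rows
    case (arg 0 0) (arg 0 1)
      (call 6 (tup [var 1,
        case (fst (arg 2 3)) (arg 2 1)
          (call 5 (tup [arg 4 1, arg 4 2, fst (arg 4 4),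
            call 4 (tup [var 2, arg 4 2, fst (arg 4 4)])])),
        arg 2 2, snd (arg 2 3), snd (arg 2 4)])),
    -- 7: `sweep`, of the tables to do, their rows and adjacencies, and all tables and rows
    case (arg 0 0) nil
      (cons (call 6 (tup [arg 2 3, var 0, fst (arg 2 1), fst (arg 2 2), arg 2 4]))
        (call 7 (tup [var 1, snd (arg 2 1), snd (arg 2 2), arg 2 3, arg 2 4]))),
    -- 8: `iter`, of a counter, tables, rows and adjacencies
    case (arg 0 0) (arg 0 1)
      (call 8 (tup [var 1, call 7 (tup [arg 2 1, arg 2 2, arg 2 3, arg 2 1, arg 2 2]),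
        arg 2 2, arg 2 3])),
    -- 9: `conflict`, of two colours
    case (arg 0 0) (case (arg 0 1) tt nil)
      (case (var 0) (case (arg 2 1) nil (case (var 0) nil tt))
        (case (arg 4 1) nil (case (var 0) tt nil))),
    -- 10: `check`, of a word, a colour and two bit vectors
    case (arg 0 0) tt
      (case (fst (arg 2 2)) (call 10 (tup [var 1, arg 2 1, snd (arg 2 2), snd (arg 2 3)]))
        (case (fst (arg 4 3)) (call 10 (tup [var 3, arg 4 1, snd (arg 4 2), snd (arg 4 3)]))
          (case (call 9 (tup [arg 6 1, var 4]))
            (call 10 (tup [var 5, arg 6 1, snd (arg 6 2), snd (arg 6 3)]))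
            nil))),
    -- 11: `ext`, of a list of words, a colour, two bit vectors and a list of words
    case (arg 0 0) (arg 0 4)
      (case (call 10 (tup [var 0, arg 2 1, arg 2 2, arg 2 3]))
        (call 11 (tup [var 1, arg 2 1, arg 2 2, arg 2 3, arg 2 4]))
        (cons (cons (arg 4 1) (var 2))
          (call 11 (tup [var 3, arg 4 1, arg 4 2, arg 4 3, arg 4 4])))),
    -- 12: `gen`, of a bit vector, a matrix and two bit vectors
    case (arg 0 0) (cons nil nil)
      (bind (call 12 (tup [var 1, call 15 (tup [snd (arg 2 1)]), snd (arg 2 2), snd (arg 2 3)]))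
        (bind (snd (fst (arg 3 1)))
          (case (var 2)
            (call 11 (tup [var 1, nil, nil, nil, nil]))
            (case (fst (arg 6 2))
              (case (fst (arg 6 3))
                (call 11 (tup [var 3, nil, var 2, var 5,
                  call 11 (tup [var 3, tt, var 2, var 5,
                    call 11 (tup [var 3, cons tt nil, var 2, var 5, nil])])]))
                (call 11 (tup [var 5, cons tt nil, var 4, var 7, nil])))
              (case (fst (arg 8 3))
                (call 11 (tup [var 5, tt, var 4, var 7, nil]))
                nil))))),
    -- 13: `loopB`, of a counter, two bit vectors and three matrices
    case (arg 0 0) nil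
      (case (fst (call 8 (tup [arg 2 4, call 16 (tup [arg 2 5, arg 2 3, arg 2 2, arg 2 1]),
          arg 2 5, arg 2 4])))
        (call 13 (tup [var 1, cons nil (arg 2 1), arg 2 2, arg 2 3, arg 2 4, arg 2 5]))
        tt),
    -- 14: `loopA`, of a counter, a bit vector and three matrices
    case (arg 0 0) nil
      (case (call 13 (tup [arg 2 2, tup [tt], arg 2 1, arg 2 2, arg 2 3, arg 2 4]))
        (call 14 (tup [var 1, cons nil (arg 2 1), arg 2 2, arg 2 3, arg 2 4]))
        tt),
    -- 15: the tails of the rows of a matrix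
    case (arg 0 0) nil (cons (snd (var 0)) (call 15 (tup [var 1]))),
    -- 16: `gen` for all rows of a matrix, with a matrix and two bit vectors
    case (arg 0 0) nil
      (cons (call 12 (tup [var 0, arg 2 1, arg 2 2, arg 2 3]))
        (call 16 (tup [var 1, arg 2 1, arg 2 2, arg 2 3]))) ]

/-! ### Running times -/

/-- The constants in this and the following bounds are generous; only the dependence on the lengths
matters. -/
theorem runs_lookup (w : List Col) (t : Data) :
    Runs prog 1 (.ofList [encWord w, t]) (encBool (lookup w t)) (40 * (w.length + 1)) := by
  induction w generalizing t with
  | nil => cases t <;> exact Runs.intro rfl (by simp [lookup])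
  | cons c w ih =>
    refine Runs.intro rfl ?_
    cases c
    · obtain ⟨s, hs, h⟩ := ih t.fst
      simp [lookup] at h hs ⊢
      exact ⟨_, h, by omega⟩
    · obtain ⟨s, hs, h⟩ := ih t.snd.fst
      simp [lookup] at h hs ⊢
      exact ⟨_, h, by omega⟩
    · obtain ⟨s, hs, h⟩ := ih t.snd.snd
      simp [lookup] at h hs ⊢
      exact ⟨_, h, by omega⟩

theorem runs_ins (w : List Col) (t : Data) :
    Runs prog 2 (.ofList [encWord w, t]) (ins w t) (60 * (w.length + 1)) := by
  induction w generalizing t with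
  | nil => exact Runs.intro rfl (by simp [ins])
  | cons c w ih =>
    refine Runs.intro rfl ?_
    cases c
    · obtain ⟨s, hs, h⟩ := ih t.fst
      simp [ins] at h hs ⊢
      exact ⟨_, h, by omega⟩
    · obtain ⟨s, hs, h⟩ := ih t.snd.fst
      simp [ins] at h hs ⊢
      exact ⟨_, h, by omega⟩
    · obtain ⟨s, hs, h⟩ := ih t.snd.snd
      simp [ins] at h hs ⊢
      exact ⟨_, h, by omega⟩

theorem runs_mask (w : List Col) (x y : List Bool) :
    Runs prog 3 (.ofList [encWord w, encBits x, encBits y]) (encWord (mask w x y))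
      (60 * (w.length + 1)) := by
  induction w generalizing x y with
  | nil => exact Runs.intro rfl (by simp [mask])
  | cons c w ih =>
    refine Runs.intro rfl ?_
    obtain ⟨s, hs, h⟩ := ih x.tail y.tail
    simp [mask] at h hs ⊢
    cases hd x <;> cases hy : hd y <;> simp [hy] <;> exact ⟨_, h, by omega⟩

@[simp] theorem length_mask (w : List Col) (x y : List Bool) :
    (mask w x y).length = w.length := by
  induction w generalizing x y with
  | nil => rfl
  | cons c w ih => simp [mask, ih]

theorem runs_build {n : ℕ} (L : List (List Col)) (x y : List Bool)
    (hL : ∀ w ∈ L, w.length ≤ n) :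
    Runs prog 4 (.ofList [encWords L, encBits x, encBits y]) (build x y L)
      (200 * (L.length + 1) * (n + 1)) := by
  induction L with
  | nil => exact Runs.intro rfl (by simp [build]; omega)
  | cons w L ih =>
    refine Runs.intro rfl ?_
    have hw := hL w (by simp)
    obtain ⟨s, hs, h⟩ := ih fun w hw => hL w (by simp [hw])
    obtain ⟨s', hs', h'⟩ := runs_mask w x y
    obtain ⟨s'', hs'', h''⟩ := runs_ins (mask w x y) (build x y L)
    simp [build] at h h' h'' hs'' ⊢
    refine ⟨_, _, h', _, _, h, _, h'', ?_⟩
    nlinarith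

theorem runs_filt {n : ℕ} (L : List (List Col)) (x y : List Bool) (t : Data)
    (hL : ∀ w ∈ L, w.length ≤ n) :
    Runs prog 5 (.ofList [encWords L, encBits x, encBits y, t]) (encWords (filt x y t L))
      (250 * (L.length + 1) * (n + 1)) := by
  induction L with
  | nil => exact Runs.intro rfl (by simp [filt]; omega)
  | cons w L ih =>
    refine Runs.intro rfl ?_
    have hw := hL w (by simp)
    obtain ⟨s, hs, h⟩ := ih fun w hw => hL w (by simp [hw])
    obtain ⟨s', hs', h'⟩ := runs_mask w x y
    obtain ⟨s'', hs'', h''⟩ := runs_lookup (mask w x y) t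
    simp [filt] at h h' h'' hs'' ⊢
    refine ⟨_, _, h', _, _, h'', ?_⟩
    cases lookup (mask w x y) t <;> simp <;> refine ⟨_, h, ?_⟩ <;> nlinarith

theorem filt_sublist (x y : List Bool) (t : Data) (L : List (List Col)) :
    (filt x y t L).Sublist L := by
  induction L with
  | nil => exact .slnil
  | cons w L ih =>
    simp only [filt]
    split
    · exact ih.cons_cons w
    · exact ih.cons w

/-- A list of at most `K` words of length at most `n`. -/
def IsTable (n K : ℕ) (L : List (List Col)) : Prop :=
  L.length ≤ K ∧ ∀ w ∈ L, w.length ≤ n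

theorem IsTable.sublist {n K : ℕ} {L L' : List (List Col)} (h : IsTable n K L)
    (hs : L'.Sublist L) : IsTable n K L' :=
  ⟨hs.length_le.trans h.1, fun w hw => h.2 w (hs.subset hw)⟩

theorem runs_revise {n K : ℕ} (x : List Bool) (L : List (List Col)) (adj : List Bool)
    (tabs : List (List (List Col))) (xs : List (List Bool)) (hL : IsTable n K L)
    (htabs : ∀ L' ∈ tabs, IsTable n K L') :
    Runs prog 6 (.ofList [encTabs tabs, encWords L, encBits x, encBits adj, encRows xs])
      (encWords (revise x L adj tabs xs)) (700 * (tabs.length + 1) * ((K + 1) * (n + 1))) := by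
  have hpos : 0 < (K + 1) * (n + 1) := by positivity
  induction tabs generalizing L adj xs with
  | nil => exact Runs.intro rfl (by simp [revise]; omega)
  | cons L' tabs ih =>
    refine Runs.intro rfl ?_
    have hL' := htabs L' (by simp)
    have htabs' : ∀ L'' ∈ tabs, IsTable n K L'' := fun L'' h => htabs L'' (by simp [h])
    simp [revise]
    cases hd adj
    · obtain ⟨s, hs, h⟩ := ih L adj.tail xs.tail hL htabs'
      simp at h ⊢
      exact ⟨_, h, by nlinarith⟩
    · obtain ⟨s₁, hs₁, h₁⟩ := runs_build L' x (hdRow xs) hL'.2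
      obtain ⟨s₂, hs₂, h₂⟩ := runs_filt L x (hdRow xs) (build x (hdRow xs) L') hL.2
      obtain ⟨s, hs, h⟩ := ih (filt x (hdRow xs) (build x (hdRow xs) L') L) adj.tail xs.tail
        (hL.sublist (filt_sublist ..)) htabs'
      simp at h h₁ h₂ ⊢
      refine ⟨_, _, h₁, _, _, h₂, _, h, ?_⟩
      have e₁ : (L'.length + 1) * (n + 1) ≤ (K + 1) * (n + 1) :=
        Nat.mul_le_mul_right _ (by have := hL'.1; omega)
      have e₂ : (L.length + 1) * (n + 1) ≤ (K + 1) * (n + 1) :=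
        Nat.mul_le_mul_right _ (by have := hL.1; omega)
      nlinarith

theorem revise_sublist (x : List Bool) (L : List (List Col)) (adj : List Bool)
    (tabs : List (List (List Col))) (xs : List (List Bool)) :
    (revise x L adj tabs xs).Sublist L := by
  induction tabs generalizing L adj xs with
  | nil => exact .refl _
  | cons L' tabs ih =>
    refine (ih _ _ _).trans ?_
    split
    · exact filt_sublist ..
    · exact .refl _

theorem runs_sweep {n K : ℕ} (tabs : List (List (List Col))) (X : List (List Bool))
    (todo : List (List (List Col))) (todoX todoT : List (List Bool))
    (htodo : ∀ L ∈ todo, IsTable n K L) (htabs : ∀ L ∈ tabs, IsTable n K L) :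
    Runs prog 7 (.ofList [encTabs todo, encRows todoX, encRows todoT, encTabs tabs, encRows X])
      (encTabs (sweep tabs X todo todoX todoT))
      (800 * (todo.length + 1) * ((tabs.length + 1) * ((K + 1) * (n + 1)))) := by
  have hpos : 0 < (K + 1) * (n + 1) := by positivity
  induction todo generalizing todoX todoT with
  | nil => exact Runs.intro rfl (by simp [sweep]; nlinarith)
  | cons L todo ih =>
    refine Runs.intro rfl ?_
    obtain ⟨s₁, hs₁, h₁⟩ := runs_revise (hdRow todoX) L (hdRow todoT) tabs X
      (htodo L (by simp)) htabs
    obtain ⟨s₂, hs₂, h₂⟩ := ih todoX.tail todoT.tail fun L h => htodo L (by simp [h])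
    simp [sweep] at h₁ h₂ ⊢
    refine ⟨_, h₁, _, h₂, ?_⟩
    nlinarith

theorem isTable_sweep {n K : ℕ} (tabs : List (List (List Col))) (X : List (List Bool))
    (todo : List (List (List Col))) (todoX todoT : List (List Bool))
    (htodo : ∀ L ∈ todo, IsTable n K L) :
    ∀ L ∈ sweep tabs X todo todoX todoT, IsTable n K L := by
  induction todo generalizing todoX todoT with
  | nil => simp [sweep]
  | cons L todo ih =>
    simp only [sweep, List.mem_cons]
    rintro L' (rfl | h)
    · exact (htodo L (by simp)).sublist (revise_sublist ..)
    · exact ih _ _ (fun L h => htodo L (by simp [h])) L' h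

@[simp] theorem length_sweep (tabs : List (List (List Col))) (X : List (List Bool))
    (todo : List (List (List Col))) (todoX todoT : List (List Bool)) :
    (sweep tabs X todo todoX todoT).length = todo.length := by
  induction todo generalizing todoX todoT with
  | nil => rfl
  | cons L todo ih => simp [sweep, ih]

theorem runs_iter {n K N : ℕ} (X T cnt : List (List Bool)) (tabs : List (List (List Col)))
    (htabs : ∀ L ∈ tabs, IsTable n K L) (hN : tabs.length = N) :
    Runs prog 8 (.ofList [encRows cnt, encTabs tabs, encRows X, encRows T])
      (encTabs (iter X T cnt tabs))
      (900 * (cnt.length + 1) * ((N + 1) * ((N + 1) * ((K + 1) * (n + 1))))) := by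
  have hpos : 0 < (N + 1) * ((N + 1) * ((K + 1) * (n + 1))) := by positivity
  induction cnt generalizing tabs with
  | nil => exact Runs.intro rfl (by simp [iter]; omega)
  | cons c cnt ih =>
    refine Runs.intro rfl ?_
    obtain ⟨s₁, hs₁, h₁⟩ := runs_sweep tabs X tabs X T htabs htabs
    obtain ⟨s₂, hs₂, h₂⟩ := ih (sweep tabs X tabs X T) (isTable_sweep _ _ _ _ _ htabs)
      (by simpa)
    simp [iter] at h₁ h₂ ⊢
    refine ⟨_, _, h₁, _, h₂, ?_⟩
    rw [hN] at hs₁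
    nlinarith

theorem runs_conflict (c d : Col) :
    Runs prog 9 (.ofList [c.enc, d.enc]) (encBool (conflict c d)) 20 := by
  cases c <;> cases d <;> exact Runs.intro rfl (by simp [conflict])

theorem runs_check (c : Col) (w : List Col) (row x : List Bool) :
    Runs prog 10 (.ofList [encWord w, c.enc, encBits row, encBits x])
      (encBool (check c w row x)) (120 * (w.length + 1)) := by
  induction w generalizing row x with
  | nil => exact Runs.intro rfl (by simp [check])
  | cons d w ih =>
    refine Runs.intro rfl ?_
    obtain ⟨s, hs, h⟩ := ih row.tail x.tail
    obtain ⟨s', hs', h'⟩ := runs_conflict c d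
    simp [check] at h h' hs ⊢
    cases hd row <;> simp
    · exact ⟨_, h, by omega⟩
    cases hd x <;> simp
    · exact ⟨_, h, by omega⟩
    refine ⟨_, _, h', ?_⟩
    cases conflict c d <;> simp
    · exact ⟨_, h, by omega⟩
    · omega

theorem runs_ext {n : ℕ} (c : Col) (row x : List Bool) (acc L : List (List Col))
    (hL : ∀ w ∈ L, w.length ≤ n) :
    Runs prog 11 (.ofList [encWords L, c.enc, encBits row, encBits x, encWords acc])
      (encWords (ext c row x acc L)) (250 * (L.length + 1) * (n + 1)) := by
  induction L with
  | nil => exact Runs.intro rfl (by simp [ext]; omega)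
  | cons w L ih =>
    refine Runs.intro rfl ?_
    have hw := hL w (by simp)
    obtain ⟨s, hs, h⟩ := ih fun w hw => hL w (by simp [hw])
    obtain ⟨s', hs', h'⟩ := runs_check c w row x
    simp [ext] at h h' ⊢
    refine ⟨_, _, h', ?_⟩
    cases check c w row x <;> simp <;> refine ⟨_, h, ?_⟩ <;> nlinarith

theorem runs_tails (M : List (List Bool)) :
    Runs prog 15 (.ofList [encRows M]) (encRows (M.map List.tail)) (30 * (M.length + 1)) := by
  induction M with
  | nil => exact Runs.intro rfl (by simp)
  | cons x M ih =>
    refine Runs.intro rfl ?_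
    obtain ⟨s, hs, h⟩ := ih
    simp at h ⊢
    exact ⟨_, h, by omega⟩

theorem ext_eq (c : Col) (row x : List Bool) (acc L : List (List Col)) :
    ext c row x acc L = (L.filter fun w => check c w row x).map (c :: ·) ++ acc := by
  induction L with
  | nil => rfl
  | cons w L ih =>
    simp only [ext, ih, List.filter_cons]
    split <;> rfl

theorem check_nil (c : Col) (w : List Col) (x : List Bool) : check c w [] x = true := by
  induction w generalizing x with
  | nil => rfl
  | cons d w ih => simp [check, ih]

theorem gen_cons_false (x : List Bool) (M : List (List Bool)) (a b : List Bool) :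
    gen (false :: x) M a b =
      (gen x (M.tail.map List.tail) a.tail b.tail).map (Col.s :: ·) := by
  simp [gen, ext_eq, check_nil]

theorem length_of_mem_gen {x : List Bool} {M : List (List Bool)} {a b : List Bool}
    {w : List Col} (hw : w ∈ gen x M a b) : w.length = x.length := by
  induction x generalizing M a b w with
  | nil => simp_all [gen]
  | cons i x ih =>
    have key (L : List (List Col)) (hL : ∀ w ∈ L, w.length = x.length) (c : Col)
        (row y : List Bool) (acc : List (List Col)) (hacc : ∀ w ∈ acc, w.length = x.length + 1) :
        ∀ w ∈ ext c row y acc L, w.length = x.length + 1 := by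
      intro w
      rw [ext_eq, List.mem_append, List.mem_map]
      rintro (⟨w', hw', rfl⟩ | h)
      · simp [hL w' (List.mem_of_mem_filter hw')]
      · exact hacc w h
    have hL := fun w => ih (M := M.tail.map List.tail) (a := a.tail) (b := b.tail) (w := w)
    simp only [gen] at hw
    split at hw
    · split at hw
      · split at hw
        · simp at hw
        · exact key _ hL _ _ _ _ (by simp) _ hw
      · split at hw
        · exact key _ hL _ _ _ _ (by simp) _ hw
        · exact key _ hL _ _ _ _ (key _ hL _ _ _ _ (key _ hL _ _ _ _ (by simp))) _ hw
    · exact key _ hL _ _ _ _ (by simp) _ hw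

/-- The hypothesis bounds the number of colourings of all the sets of vertices that arise from `x`
by omitting an initial segment, hence the length of all the lists in the recursion. -/
theorem runs_gen {n K : ℕ} (x : List Bool) (M : List (List Bool)) (a b : List Bool)
    (hx : x.length ≤ n) (hM : M.length ≤ n)
    (hK : ∀ i ≤ x.length, (gen (List.replicate i false ++ x.drop i) M a b).length ≤ K) :
    Runs prog 12 (.ofList [encBits x, encRows M, encBits a, encBits b])
      (encWords (gen x M a b)) (1000 * (x.length + 1) * ((K + 1) * (n + 1))) := by
  have hpos : 0 < (K + 1) * (n + 1) := by positivity
  induction x generalizing M a b with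
  | nil => exact Runs.intro rfl (by simp [gen]; omega)
  | cons i x ih =>
    have hK' : ∀ i ≤ x.length, (gen (List.replicate i false ++ x.drop i)
        (M.tail.map List.tail) a.tail b.tail).length ≤ K := by
      intro j hj
      have := hK (j + 1) (by simpa using hj)
      rwa [List.replicate_succ, List.cons_append, gen_cons_false, List.length_map] at this
    have hx' : x.length ≤ n := by simp at hx; omega
    obtain ⟨s₁, hs₁, h₁⟩ := runs_tails M.tail
    obtain ⟨s, hs, h⟩ := ih (M.tail.map List.tail) a.tail b.tail hx'
      (by simp; omega) hK'
    have hL₁ : (gen x (M.tail.map List.tail) a.tail b.tail).length ≤ K := by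
      simpa using hK' 0 (Nat.zero_le _)
    have hL₂ : ∀ w ∈ gen x (M.tail.map List.tail) a.tail b.tail, w.length ≤ n :=
      fun w hw => (length_of_mem_gen hw).le.trans hx'
    refine Runs.intro rfl ?_
    have ht : M.tail.length ≤ n := by simp; omega
    simp [gen, -List.map_tail] at h h₁ ⊢
    generalize gen x (M.tail.map List.tail) a.tail b.tail = L at *
    have e : (L.length + 1) * (n + 1) ≤ (K + 1) * (n + 1) := Nat.mul_le_mul_right _ (by omega)
    have e' : n + 1 ≤ (K + 1) * (n + 1) := Nat.le_mul_of_pos_left _ (by omega)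
    have hext (c : Col) (row y : List Bool) (acc : List (List Col)) :
        ∃ s ≤ 250 * ((K + 1) * (n + 1)), Fn prog 11 (.ofList
          [encWords L, c.enc, encBits row, encBits y, encWords acc])
          (encWords (ext c row y acc L)) s := by
      obtain ⟨s, hs, h⟩ := runs_ext c row y acc L hL₂
      exact ⟨s, hs.trans (by nlinarith), h⟩
    refine ⟨_, _, h₁, _, _, h, ?_⟩
    have hs₁' : s₁ ≤ 30 * ((K + 1) * (n + 1)) := by omega
    have hm : 1000 * (x.length + 1 + 1) * ((K + 1) * (n + 1)) =
        1000 * (x.length + 1) * ((K + 1) * (n + 1)) + 1000 * ((K + 1) * (n + 1)) := by ring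
    rw [hm]
    cases i
    · obtain ⟨t, ht, k⟩ := hext .s [] [] []
      simp at k ⊢
      exact ⟨_, k, by omega⟩
    cases ha : hd a <;> cases hb : hd b
    · obtain ⟨t₁, ht₁, k₁⟩ := hext .b (hdRow M).tail x []
      obtain ⟨t₂, ht₂, k₂⟩ := hext .a (hdRow M).tail x (ext .b (hdRow M).tail x [] L)
      obtain ⟨t₃, ht₃, k₃⟩ := hext .s (hdRow M).tail x
        (ext .a (hdRow M).tail x (ext .b (hdRow M).tail x [] L) L)
      simp [ha, hb] at k₁ k₂ k₃ ⊢
      exact ⟨_, _, k₁, _, _, k₂, _, k₃, by omega⟩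
    · obtain ⟨t, ht, k⟩ := hext .b (hdRow M).tail x []
      simp [ha, hb] at k ⊢
      exact ⟨_, k, by omega⟩
    · obtain ⟨t, ht, k⟩ := hext .a (hdRow M).tail x []
      simp [ha, hb] at k ⊢
      exact ⟨_, k, by omega⟩
    · simp [ha, hb]
      omega

theorem runs_genAll {n K : ℕ} (X M : List (List Bool)) (a b : List Bool)
    (hX : ∀ x ∈ X, x.length ≤ n) (hM : M.length ≤ n)
    (hK : ∀ x ∈ X, ∀ i ≤ x.length, (gen (List.replicate i false ++ x.drop i) M a b).length ≤ K) :
    Runs prog 16 (.ofList [encRows X, encRows M, encBits a, encBits b])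
      (encTabs (X.map fun x => gen x M a b))
      (1100 * (X.length + 1) * ((n + 1) * ((K + 1) * (n + 1)))) := by
  have hpos : 0 < (n + 1) * ((K + 1) * (n + 1)) := by positivity
  induction X with
  | nil => exact Runs.intro rfl (by simp; omega)
  | cons x X ih =>
    obtain ⟨s, hs, h⟩ := ih (fun x h => hX x (by simp [h])) (fun x h => hK x (by simp [h]))
    obtain ⟨s', hs', h'⟩ := runs_gen x M a b (hX x (by simp)) hM (hK x (by simp))
    refine Runs.intro rfl ?_
    simp at h h' ⊢
    refine ⟨_, h', _, h, ?_⟩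
    have : (x.length + 1) * ((K + 1) * (n + 1)) ≤ (n + 1) * ((K + 1) * (n + 1)) :=
      Nat.mul_le_mul_right _ (by have := hX x (by simp); omega)
    nlinarith

/-- The bound for the time spent on a pair of vertices. -/
def pairCost (n N K : ℕ) : ℕ :=
  3000 * ((N + 1) * ((N + 1) * ((n + N + 1) * ((K + 1) * (n + 1)))))

theorem runs_loopB {n N K : ℕ} (a : List Bool) (G T X cnt : List (List Bool)) (b : List Bool)
    (hX : ∀ x ∈ X, x.length ≤ n) (hG : G.length ≤ n) (hT : T.length = N) (hXN : X.length = N)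
    (hK : ∀ b, ∀ x ∈ X, ∀ i ≤ x.length,
      (gen (List.replicate i false ++ x.drop i) G a b).length ≤ K) :
    Runs prog 13 (.ofList [encRows cnt, encBits b, encBits a, encRows G, encRows T, encRows X])
      (encBool (loopB a G T X cnt b)) ((cnt.length + 1) * pairCost n N K) := by
  have hpos : 3000 ≤ pairCost n N K := Nat.le_mul_of_pos_right _ (by positivity)
  induction cnt generalizing b with
  | nil => exact Runs.intro rfl (by simp [loopB]; omega)
  | cons c cnt ih =>
    obtain ⟨s, hs, h⟩ := ih (false :: b)
    obtain ⟨s₁, hs₁, h₁⟩ := runs_genAll X G a b hX hG (hK b)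
    obtain ⟨s₂, hs₂, h₂⟩ := runs_iter (n := n) (K := K) (N := N) X T T
      (X.map fun x => gen x G a b)
      (by
        intro L hL
        obtain ⟨x, hx, rfl⟩ := List.mem_map.1 hL
        exact ⟨by simpa using hK b x hx 0 (Nat.zero_le _),
          fun w hw => (length_of_mem_gen hw).le.trans (hX x hx)⟩)
      (by simpa)
    refine Runs.intro rfl ?_
    -- Generating the tables costs `1100 * _`, the rounds cost `900 * _`; the rest is constant.
    have hcost : s₁ + s₂ + 200 ≤ pairCost n N K := by
      rw [hT] at hs₂
      rw [hXN] at hs₁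
      obtain ⟨Q, hQ⟩ : ∃ Q, Q = (K + 1) * (n + 1) := ⟨_, rfl⟩
      have hQ₀ : 0 < Q := by rw [hQ]; positivity
      rw [← hQ] at hs₁ hs₂
      have e₁ : (N + 1) * ((n + 1) * Q) ≤
          (N + 1) * ((N + 1) * ((n + N + 1) * Q)) := by
        refine Nat.mul_le_mul_left _ ?_
        refine le_trans ?_ (Nat.le_mul_of_pos_left _ (Nat.succ_pos N))
        exact Nat.mul_le_mul_right _ (by omega)
      have e₂ : (N + 1) * ((N + 1) * ((N + 1) * Q)) ≤
          (N + 1) * ((N + 1) * ((n + N + 1) * Q)) :=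
        Nat.mul_le_mul_left _ (Nat.mul_le_mul_left _ (Nat.mul_le_mul_right _ (by omega)))
      have e₃ : 0 < (N + 1) * ((N + 1) * ((n + N + 1) * Q)) := by positivity
      rw [pairCost, ← hQ]
      rw [mul_assoc] at hs₁ hs₂
      omega
    simp [loopB] at h h₁ h₂ ⊢
    refine ⟨_, _, h₁, _, _, h₂, ?_⟩
    have hm : (cnt.length + 1 + 1) * pairCost n N K
      = (cnt.length + 1) * pairCost n N K + pairCost n N K := by ring
    rcases iter X T T (X.map fun x => gen x G a b) with _ | ⟨_ | ⟨w, L⟩, tabs⟩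
    · simp
      exact ⟨_, h, by omega⟩
    · simp
      exact ⟨_, h, by omega⟩
    · simp
      nlinarith

theorem runs_loopA {n N K : ℕ} (G T X cnt : List (List Bool)) (a : List Bool)
    (hX : ∀ x ∈ X, x.length ≤ n) (hG : G.length ≤ n) (hT : T.length = N) (hXN : X.length = N)
    (hK : ∀ a b, ∀ x ∈ X, ∀ i ≤ x.length,
      (gen (List.replicate i false ++ x.drop i) G a b).length ≤ K) :
    Runs prog 14 (.ofList [encRows cnt, encBits a, encRows G, encRows T, encRows X])
      (encBool (loopA G T X cnt a)) ((cnt.length + 1) * ((n + 2) * pairCost n N K)) := by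
  have hpos : 3000 ≤ pairCost n N K := Nat.le_mul_of_pos_right _ (by positivity)
  induction cnt generalizing a with
  | nil => exact Runs.intro rfl (by simp [loopA]; nlinarith)
  | cons c cnt ih =>
    obtain ⟨s, hs, h⟩ := ih (false :: a)
    obtain ⟨s₁, hs₁, h₁⟩ := runs_loopB a G T X G [true] hX hG hT hXN (hK a)
    refine Runs.intro rfl ?_
    simp [loopA] at h h₁ ⊢
    refine ⟨_, _, h₁, ?_⟩
    have hm : (G.length + 1) * pairCost n N K ≤ (n + 1) * pairCost n N K :=
      Nat.mul_le_mul_right _ (by omega)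
    cases loopB a G T X G [true]
    · simp
      exact ⟨_, h, by nlinarith⟩
    · simp
      nlinarith

theorem runs_prog {n N K : ℕ} (G T X : List (List Bool)) (r u : Data)
    (hX : ∀ x ∈ X, x.length ≤ n) (hG : G.length ≤ n) (hT : T.length = N) (hXN : X.length = N)
    (hK : ∀ a b, ∀ x ∈ X, ∀ i ≤ x.length,
      (gen (List.replicate i false ++ x.drop i) G a b).length ≤ K) :
    Runs prog 0 (.ofList [encRows G, encRows T, r, encRows X, u])
      (encBool (loopA G T X G [true])) ((n + 2) * ((n + 2) * pairCost n N K)) := by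
  have hpos : 3000 ≤ pairCost n N K := Nat.le_mul_of_pos_right _ (by positivity)
  obtain ⟨s, hs, h⟩ := runs_loopA G T X G [true] hX hG hT hXN hK
  refine Runs.intro rfl ?_
  simp at h ⊢
  refine ⟨_, h, ?_⟩
  have hm : (G.length + 1) * ((n + 2) * pairCost n N K) ≤ (n + 1) * ((n + 2) * pairCost n N K) :=
      Nat.mul_le_mul_right _ (by omega)
  nlinarith

/-! ### What the functions of the program compute -/

theorem hd_eq_getD (x : List Bool) : hd x = x.getD 0 false := rfl

theorem hdRow_eq_getD (x : List (List Bool)) : hdRow x = x.getD 0 [] := rfl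

theorem getD_tail {α : Type*} (x : List α) (i : ℕ) (d : α) :
    x.tail.getD i d = x.getD (i + 1) d := by
  cases x <;> simp

theorem getD_map_tail {α : Type*} (M : List (List α)) (i j : ℕ) (d : α) :
    ((M.map List.tail).getD i []).getD j d = (M.getD i []).getD (j + 1) d := by
  by_cases h : i < M.length
  · simp [h]
  · simp [Nat.not_lt.1 h]

theorem lookup_nil (w : List Col) : lookup w .nil = false := by
  induction w with
  | nil => rfl
  | cons c w ih => cases c <;> exact ih

/-- Words of one length, inserted into a trie, do not interfere with each other. -/
theorem lookup_ins {w w' : List Col} (t : Data) (h : w.length = w'.length) :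
    lookup w (ins w' t) = true ↔ w = w' ∨ lookup w t = true := by
  induction w generalizing w' t with
  | nil =>
    obtain rfl : w' = [] := List.length_eq_zero_iff.1 h.symm
    simp [ins, lookup]
  | cons c w ih =>
    obtain _ | ⟨c', w'⟩ := w'
    · simp at h
    have h' : w.length = w'.length := by simpa using h
    cases c <;> cases c' <;> simp [ins, lookup, ih _ h']

theorem lookup_build {n : ℕ} (x y : List Bool) {L : List (List Col)} {w : List Col}
    (hL : ∀ w ∈ L, w.length = n) (hw : w.length = n) :
    lookup w (build x y L) = true ↔ ∃ w' ∈ L, w = mask w' x y := by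
  induction L with
  | nil => simp [build, lookup_nil]
  | cons w' L ih =>
    rw [build, lookup_ins _ (by rw [length_mask, hw, hL w' (by simp)]),
      ih fun w h => hL w (by simp [h])]
    simp

theorem mask_eq_mask_iff {w w' : List Col} (x y : List Bool) (h : w.length = w'.length) :
    mask w x y = mask w' x y ↔ ∀ i, x.getD i false = true → y.getD i false = true →
      w.getD i .s = w'.getD i .s := by
  induction w generalizing w' x y with
  | nil =>
    obtain rfl : w' = [] := List.length_eq_zero_iff.1 h.symm
    simp
  | cons c w ih =>
    obtain _ | ⟨c', w'⟩ := w'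
    · simp at h
    have h' : w.length = w'.length := by simpa using h
    rw [← Nat.and_forall_add_one]
    simp only [mask, List.cons.injEq, ih x.tail y.tail h', getD_tail, ← hd_eq_getD,
      List.getD_cons_zero, List.getD_cons_succ]
    refine and_congr_left fun _ => ?_
    cases hd x <;> cases hd y <;> simp

theorem mem_filt {x y : List Bool} {t : Data} {L : List (List Col)} {w : List Col} :
    w ∈ filt x y t L ↔ w ∈ L ∧ lookup (mask w x y) t = true := by
  induction L with
  | nil => simp [filt]
  | cons w' L ih =>
    simp only [filt]
    split <;> simp only [List.mem_cons, ih] <;> grind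

/-- Revision keeps the words that agree on the common vertices with some word of each neighbour. -/
theorem mem_revise {n : ℕ} {x : List Bool} {L : List (List Col)} {adj : List Bool}
    {tabs : List (List (List Col))} {xs : List (List Bool)} (hL : ∀ w ∈ L, w.length = n)
    (htabs : ∀ L' ∈ tabs, ∀ w ∈ L', w.length = n) {w : List Col} :
    w ∈ revise x L adj tabs xs ↔ w ∈ L ∧ ∀ c < tabs.length, adj.getD c false = true →
      ∃ w' ∈ tabs.getD c [], ∀ i, x.getD i false = true → (xs.getD c []).getD i false = true →
        w.getD i .s = w'.getD i .s := by
  induction tabs generalizing L adj xs with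
  | nil => simp [revise]
  | cons L' tabs ih =>
    have hL' := htabs L' (by simp)
    have htabs' : ∀ L'' ∈ tabs, ∀ w ∈ L'', w.length = n := fun L'' h => htabs L'' (by simp [h])
    have hsub : ∀ w ∈ (if hd adj then filt x (hdRow xs) (build x (hdRow xs) L') L else L),
        w.length = n := by
      intro w hw
      split at hw
      · exact hL w ((filt_sublist ..).subset hw)
      · exact hL w hw
    rw [revise, ih hsub htabs']
    have hfirst : w ∈ (if hd adj then filt x (hdRow xs) (build x (hdRow xs) L') L else L) ↔
        w ∈ L ∧ (adj.getD 0 false = true → ∃ w' ∈ L', ∀ i, x.getD i false = true →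
          (xs.getD 0 []).getD i false = true → w.getD i .s = w'.getD i .s) := by
      rw [hd_eq_getD, hdRow_eq_getD]
      split
      · rename_i h
        rw [mem_filt]
        refine and_congr_right fun hw => ?_
        rw [lookup_build (n := n) _ _ hL' (by rw [length_mask, hL w hw])]
        simp only [h, true_imp_iff]
        refine exists_congr fun w' => and_congr_right fun hw' => ?_
        exact mask_eq_mask_iff _ _ (by rw [hL w hw, hL' w' hw'])
      · simp_all
    rw [hfirst, and_assoc]
    refine and_congr_right fun _ => ?_
    simp only [getD_tail, List.length_cons]
    constructor
    · rintro ⟨h₀, h₁⟩ (_ | c) hc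
      · simpa using h₀
      · simpa using h₁ c (by omega)
    · intro h
      exact ⟨by simpa using h 0 (by omega), fun c hc => by simpa using h (c + 1) (by omega)⟩

theorem getD_sweep (tabs : List (List (List Col))) (X : List (List Bool))
    (todo : List (List (List Col))) (todoX todoT : List (List Bool)) {i : ℕ}
    (hi : i < todo.length) :
    (sweep tabs X todo todoX todoT).getD i [] =
      revise (todoX.getD i []) (todo.getD i []) (todoT.getD i []) tabs X := by
  induction todo generalizing todoX todoT i with
  | nil => simp at hi
  | cons L todo ih =>
    cases i with
    | zero => rfl
    | succ i =>
      rw [sweep, List.getD_cons_succ, ih _ _ (by simpa using hi)]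
      simp only [getD_tail, List.getD_cons_succ]

/-- The tables after `k` rounds. -/
def tables (X T : List (List Bool)) (tabs : List (List (List Col))) :
    ℕ → List (List (List Col))
  | 0 => tabs
  | k + 1 => sweep (tables X T tabs k) X (tables X T tabs k) X T

/-- The program passes the tables of the first round on, whereas `tables` appends the last round. -/
theorem iter_eq_tables (X T cnt : List (List Bool)) (tabs : List (List (List Col))) :
    iter X T cnt tabs = tables X T tabs cnt.length := by
  have shift (k : ℕ) (tabs) :
      tables X T (sweep tabs X tabs X T) k = tables X T tabs (k + 1) := by
    induction k with
    | zero => rfl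
    | succ k ih => rw [tables, ih]; rfl
  induction cnt generalizing tabs with
  | nil => rfl
  | cons c cnt ih => rw [iter, ih, shift, List.length_cons]

theorem length_tables (X T : List (List Bool)) (tabs : List (List (List Col))) (k : ℕ) :
    (tables X T tabs k).length = tabs.length := by
  induction k with
  | zero => rfl
  | succ k ih => rw [tables, length_sweep, ih]

theorem mem_tables_zero_of_mem (X T : List (List Bool)) (tabs : List (List (List Col))) (k i : ℕ)
    {w : List Col} (h : w ∈ (tables X T tabs k).getD i []) : w ∈ tabs.getD i [] := by
  induction k with
  | zero => exact h
  | succ k ih =>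
    rw [tables] at h
    by_cases hi : i < (tables X T tabs k).length
    · rw [getD_sweep _ _ _ _ _ hi] at h
      exact ih ((revise_sublist ..).subset h)
    · rw [List.getD_eq_default] at h
      · simp at h
      · simpa using hi

theorem mem_tables_succ {n : ℕ} {X T : List (List Bool)} {tabs : List (List (List Col))}
    (htabs : ∀ i, ∀ w ∈ tabs.getD i [], w.length = n) (k : ℕ) {i : ℕ} (hi : i < tabs.length)
    {w : List Col} :
    w ∈ (tables X T tabs (k + 1)).getD i [] ↔ w ∈ (tables X T tabs k).getD i [] ∧
      ∀ c < tabs.length, (T.getD i []).getD c false = true →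
        ∃ w' ∈ (tables X T tabs k).getD c [], ∀ v, (X.getD i []).getD v false = true →
          (X.getD c []).getD v false = true → w.getD v .s = w'.getD v .s := by
  have hlen : ∀ i, ∀ w ∈ (tables X T tabs k).getD i [], w.length = n :=
    fun i w hw => htabs i w (mem_tables_zero_of_mem X T tabs k i hw)
  rw [tables, getD_sweep _ _ _ _ _ (by rwa [length_tables]), mem_revise (n := n) (hlen i),
    length_tables]
  intro L hL
  obtain ⟨j, hj, rfl⟩ := List.getElem_of_mem hL
  have := hlen j
  rwa [List.getD_eq_getElem _ _ hj] at this

theorem check_eq_true_iff (c : Col) (w : List Col) (row x : List Bool) :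
    check c w row x = true ↔ ∀ j < w.length, row.getD j false = true → x.getD j false = true →
      conflict c (w.getD j .s) = false := by
  induction w generalizing row x with
  | nil => simp [check]
  | cons d w ih =>
    have : (∀ j < (d :: w).length, row.getD j false = true → x.getD j false = true →
        conflict c ((d :: w).getD j .s) = false) ↔
        (row.getD 0 false = true → x.getD 0 false = true → conflict c d = false) ∧
        check c w row.tail x.tail = true := by
      rw [ih]
      simp only [getD_tail]
      constructor
      · intro h
        exact ⟨h 0 (by simp), fun j hj => h (j + 1) (by simpa using hj)⟩
      · rintro ⟨h₀, h₁⟩ (_ | j) hj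
        · simpa using h₀
        · exact h₁ j (by simpa using hj)
    rw [this, check, hd_eq_getD, hd_eq_getD]
    cases row.getD 0 false <;> cases x.getD 0 false <;> cases conflict c d <;> simp

/-- The words that `gen` enumerates, described by their letters. -/
structure IsColoring (x : List Bool) (M : List (List Bool)) (a b : List Bool) (w : List Col) :
    Prop where
  length_eq : w.length = x.length
  outside : ∀ i < x.length, x.getD i false = false → w.getD i .s = .s
  left : ∀ i < x.length, x.getD i false = true → a.getD i false = true → w.getD i .s = .a
  right : ∀ i < x.length, x.getD i false = true → b.getD i false = true → w.getD i .s = .b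
  proper : ∀ i j, i < j → j < x.length → x.getD i false = true → x.getD j false = true →
    (M.getD i []).getD j false = true → conflict (w.getD i .s) (w.getD j .s) = false

theorem isColoring_cons_iff {i : Bool} {x : List Bool} {M : List (List Bool)} {a b : List Bool}
    {c : Col} {w : List Col} : IsColoring (i :: x) M a b (c :: w) ↔
      IsColoring x (M.tail.map List.tail) a.tail b.tail w ∧ (i = false → c = .s) ∧
      (i = true → (hd a = true → c = .a) ∧ (hd b = true → c = .b) ∧
        check c w (hdRow M).tail x = true) := by
  constructor
  · rintro ⟨h₁, h₂, h₃, h₄, h₅⟩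
    have h₁' : w.length = x.length := by simpa using h₁
    refine ⟨⟨h₁', ?_, ?_, ?_, ?_⟩, ?_, ?_⟩
    · intro j hj h
      simpa using h₂ (j + 1) (by simpa using hj) (by simpa using h)
    · intro j hj h h'
      rw [getD_tail] at h'
      simpa using h₃ (j + 1) (by simpa using hj) (by simpa using h) h'
    · intro j hj h h'
      rw [getD_tail] at h'
      simpa using h₄ (j + 1) (by simpa using hj) (by simpa using h) h'
    · intro j k hjk hk h h' h''
      rw [getD_map_tail, getD_tail] at h''
      simpa using h₅ (j + 1) (k + 1) (by omega) (by simpa using hk) (by simpa using h)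
        (by simpa using h') h''
    · intro hi
      simpa using h₂ 0 (by simp) (by simpa using hi)
    · intro hi
      refine ⟨fun ha => by simpa using h₃ 0 (by simp) (by simpa using hi) ha,
        fun hb => by simpa using h₄ 0 (by simp) (by simpa using hi) hb, ?_⟩
      rw [check_eq_true_iff]
      intro j hj h h'
      rw [getD_tail, hdRow_eq_getD] at h
      simpa using h₅ 0 (j + 1) (by omega) (by simp; omega) (by simpa using hi)
        (by simpa using h') h
  · rintro ⟨⟨h₁, h₂, h₃, h₄, h₅⟩, h₆, h₇⟩
    refine ⟨by simpa using h₁, ?_, ?_, ?_, ?_⟩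
    · rintro (_ | j) hj h
      · simpa using h₆ (by simpa using h)
      · simpa using h₂ j (by simpa using hj) (by simpa using h)
    · rintro (_ | j) hj h h'
      · simpa using (h₇ (by simpa using h)).1 h'
      · rw [← getD_tail] at h'
        simpa using h₃ j (by simpa using hj) (by simpa using h) h'
    · rintro (_ | j) hj h h'
      · simpa using (h₇ (by simpa using h)).2.1 h'
      · rw [← getD_tail] at h'
        simpa using h₄ j (by simpa using hj) (by simpa using h) h'
    · rintro (_ | j) (_ | k) hjk hk h h' h''
      · omega
      · have := (check_eq_true_iff ..).1 (h₇ (by simpa using h)).2.2 k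
          (by rw [h₁]; simpa using hk) (by rwa [getD_tail]) (by simpa using h')
        simpa using this
      · omega
      · simpa using h₅ j k (by omega) (by simpa using hk) (by simpa using h) (by simpa using h')
          (by rwa [getD_map_tail, getD_tail])

theorem mem_gen {x : List Bool} {M : List (List Bool)} {a b : List Bool} {w : List Col} :
    w ∈ gen x M a b ↔ IsColoring x M a b w := by
  induction x generalizing M a b w with
  | nil =>
    simp only [gen, List.mem_singleton]
    constructor
    · rintro rfl
      exact ⟨rfl, by simp, by simp, by simp, by simp⟩
    · exact fun h => List.length_eq_zero_iff.1 h.length_eq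
  | cons i x ih =>
    have hmem (c : Col) (row y : List Bool) (acc L : List (List Col)) :
        w ∈ ext c row y acc L ↔
          (∃ w' ∈ L, check c w' row y = true ∧ c :: w' = w) ∨ w ∈ acc := by
      simp [ext_eq, and_assoc]
    obtain _ | ⟨c, w⟩ := w
    · constructor
      · exact fun h => by simpa using length_of_mem_gen h
      · exact fun h => by simpa using h.length_eq
    rw [isColoring_cons_iff, ← ih]
    simp only [gen]
    cases i
    · simp [hmem, check_nil]
      grind
    · cases hd a <;> cases hd b <;> cases c <;> simp [hmem]

theorem nodup_gen (x : List Bool) (M : List (List Bool)) (a b : List Bool) :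
    (gen x M a b).Nodup := by
  induction x generalizing M a b with
  | nil => simp [gen]
  | cons i x ih =>
    have hL := ih (M.tail.map List.tail) a.tail b.tail
    have key (c : Col) (row y : List Bool) (acc L : List (List Col)) (hL : L.Nodup)
        (hacc : acc.Nodup) (hc : ∀ w, c :: w ∉ acc) : (ext c row y acc L).Nodup := by
      rw [ext_eq]
      refine List.Nodup.append ((hL.filter _).map (List.cons_injective)) hacc ?_
      intro w hw hw'
      obtain ⟨w', -, rfl⟩ := List.mem_map.1 hw
      exact hc _ hw'
    simp only [gen]
    split
    · split
      · split
        · exact List.nodup_nil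
        · exact key _ _ _ _ _ hL List.nodup_nil (by simp)
      · split
        · exact key _ _ _ _ _ hL List.nodup_nil (by simp)
        · refine key _ _ _ _ _ hL (key _ _ _ _ _ hL (key _ _ _ _ _ hL List.nodup_nil
            (by simp)) ?_) ?_ <;> simp [ext_eq]
    · exact key _ _ _ _ _ hL List.nodup_nil (by simp)

/-! ### Cutsets as colourings -/

theorem conflict_comm (c d : Col) : conflict c d = conflict d c := by
  cases c <;> cases d <;> rfl

/-- No edge of `G` has both ends in `s`, or one end in `a` and one in `b`. -/
def IsProper {V : Type*} (G : SimpleGraph V) (F : V → Col) : Prop :=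
  ∀ u v, G.Adj u v → conflict (F u) (F v) = false

/-- The two sides of a cutset are the component of some vertex of `G - S` and the union of the other
components. -/
theorem hasIndependentCutset_iff {V : Type*} (G : SimpleGraph V) :
    HasIndependentCutset G ↔ ∃ F, IsProper G F ∧ (∃ u, F u = .a) ∧ ∃ v, F v = .b := by
  classical
  constructor
  · rintro ⟨S, hS, hcut⟩
    rw [SimpleGraph.Preconnected] at hcut
    push Not at hcut
    obtain ⟨x, y, hxy⟩ := hcut
    -- The side `a` is the component of `x` in `G - S`.
    let F : V → Col := fun v =>
      if h : v ∈ S then .s else if (G.induce Sᶜ).Reachable x ⟨v, h⟩ then .a else .b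
    refine ⟨F, ?_, ⟨x, ?_⟩, ⟨y, ?_⟩⟩
    · intro u v huv
      by_cases hu : u ∈ S
      · by_cases hv : v ∈ S
        · exact absurd huv (hS hu hv huv.ne)
        · by_cases hv' : (G.induce Sᶜ).Reachable x ⟨v, hv⟩ <;> simp [F, hu, hv, hv', conflict]
      · by_cases hv : v ∈ S
        · by_cases hu' : (G.induce Sᶜ).Reachable x ⟨u, hu⟩ <;> simp [F, hu, hv, hu', conflict]
        · have hadj : (G.induce Sᶜ).Adj ⟨u, hu⟩ ⟨v, hv⟩ := huv
          have : (G.induce Sᶜ).Reachable x ⟨u, hu⟩ ↔ (G.induce Sᶜ).Reachable x ⟨v, hv⟩ :=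
            ⟨fun h => h.trans hadj.reachable, fun h => h.trans hadj.symm.reachable⟩
          by_cases hv' : (G.induce Sᶜ).Reachable x ⟨v, hv⟩ <;>
            simp [F, hu, hv, hv', this, conflict]
    · simp only [F]
      rw [dif_neg x.2, if_pos (SimpleGraph.Reachable.refl _)]
    · simp only [F]
      rw [dif_neg y.2, if_neg hxy]
  · rintro ⟨F, hF, ⟨u, hu⟩, v, hv⟩
    refine ⟨{x | F x = .s}, ?_, ?_⟩
    · intro x hx y hy _ hxy
      have := hF x y hxy
      rw [hx, hy] at this
      cases this
    · intro h
      have key (x y : ({x | F x = .s}ᶜ : Set V))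
          (hxy : (G.induce {x | F x = .s}ᶜ).Reachable x y) (hx : F x = .a) : F y = .a := by
        obtain ⟨p⟩ := hxy
        induction p with
        | nil => exact hx
        | @cons x z y hadj p ih =>
          refine ih ?_
          have h₁ := hF x z hadj
          have h₂ : F z ≠ .s := z.2
          rw [hx] at h₁
          cases hz : F z <;> simp_all [conflict]
      have := key ⟨u, by simp [hu]⟩ ⟨v, by simp [hv]⟩ (h _ _) hu
      rw [hv] at this
      cases this

/-! ### Arc consistency on trees -/

/-- In a rooted tree the parent of a node is unique. -/
theorem eq_of_adj_of_dist_eq {ι : Type*} {T : SimpleGraph ι} (hT : T.IsTree) {r c t t' : ι}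
    (h : T.Adj t c) (h' : T.Adj t' c) (hd : T.dist r c = T.dist r t + 1)
    (hd' : T.dist r c = T.dist r t' + 1) : t = t' := by
  obtain ⟨p, hp⟩ := hT.connected.exists_walk_length_eq_dist r t
  obtain ⟨p', hp'⟩ := hT.connected.exists_walk_length_eq_dist r t'
  have hq := (p.concat h).isPath_of_length_eq_dist (by simp [hp, hd])
  have hq' := (p'.concat h').isPath_of_length_eq_dist (by simp [hp', hd'])
  have := (hT.isAcyclic.subsingleton_path r c).elim ⟨_, hq⟩ ⟨_, hq'⟩
  have := congrArg (fun q : T.Path r c => (q : T.Walk r c).penultimate) this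
  simpa using this

theorem exists_adj_of_dist_eq_add_one {ι : Type*} {T : SimpleGraph ι} (hT : T.Connected)
    {r c : ι} {d : ℕ} (hd : T.dist r c = d + 1) : ∃ t, T.Adj t c ∧ T.dist r t = d := by
  obtain ⟨p, hp⟩ := hT.exists_walk_length_eq_dist c r
  rw [SimpleGraph.dist_comm, hd] at hp
  cases p with
  | nil => simp at hp
  | @cons _ t _ h p =>
    refine ⟨t, h.symm, ?_⟩
    have h₁ : T.dist r t ≤ d := by
      rw [SimpleGraph.dist_comm]
      exact (SimpleGraph.dist_le p).trans (by simpa using hp.le)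
    have h₂ : T.dist r c ≤ T.dist r t + T.dist t c := hT.dist_triangle
    rw [SimpleGraph.dist_eq_one_iff_adj.2 h.symm] at h₂
    omega

/-- If the values in `R (k + 1) t` have support in `R k c` for all neighbours `c` of `t`, then a
value of the node `r` that survives as many rounds as the height of the tree extends to a choice of
values that agree along all edges: the values are chosen along increasing distance from `r`. -/
theorem exists_consistent {ι V C : Type*} {T : SimpleGraph ι} (hT : T.IsTree) (X : ι → Set V)
    (R : ℕ → ι → Set (V → C)) (r : ι) (D : ℕ) (hD : ∀ t, T.dist r t ≤ D)
    (hR : ∀ k t, ∀ f ∈ R (k + 1) t, ∀ c, T.Adj t c →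
      ∃ g ∈ R k c, ∀ v ∈ X t, v ∈ X c → f v = g v)
    (hr : (R D r).Nonempty) :
    ∃ g : ι → V → C, (∀ t, ∃ k, g t ∈ R k t) ∧
      ∀ t c, T.Adj t c → ∀ v ∈ X t, v ∈ X c → g t v = g c v := by
  classical
  have claim (d : ℕ) : ∃ g : ι → V → C,
      (∀ t, T.dist r t ≤ d → g t ∈ R (D - T.dist r t) t) ∧
      ∀ t c, T.Adj t c → T.dist r c = T.dist r t + 1 → T.dist r c ≤ d →
        ∀ v ∈ X t, v ∈ X c → g t v = g c v := by
    induction d with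
    | zero =>
      obtain ⟨f, hf⟩ := hr
      refine ⟨fun _ => f, fun t ht => ?_, fun t c _ h h' => by omega⟩
      obtain rfl : r = t := hT.connected.dist_eq_zero_iff.1 (by omega)
      simpa using hf
    | succ d ih =>
      obtain ⟨g, hg₁, hg₂⟩ := ih
      have hex (c : ι) : ∃ f : V → C, T.dist r c = d + 1 → f ∈ R (D - (d + 1)) c ∧
          ∀ t, T.Adj t c → T.dist r t = d → ∀ v ∈ X t, v ∈ X c → g t v = f v := by
        by_cases hc : T.dist r c = d + 1
        · obtain ⟨t, htc, ht⟩ := exists_adj_of_dist_eq_add_one hT.connected hc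
          have hgt := hg₁ t ht.le
          have hDc := hD c
          rw [ht, show D - d = D - (d + 1) + 1 by omega] at hgt
          obtain ⟨f, hf, hag⟩ := hR _ _ _ hgt c htc
          refine ⟨f, fun _ => ⟨hf, fun t' h' ht' => ?_⟩⟩
          obtain rfl := eq_of_adj_of_dist_eq (r := r) hT htc h' (by omega) (by omega)
          exact hag
        · exact ⟨g c, fun h => absurd h hc⟩
      choose f hf using hex
      refine ⟨fun t => if T.dist r t = d + 1 then f t else g t, fun t ht => ?_,
        fun t c htc hc hcd => ?_⟩
      · dsimp only
        split
        · rename_i h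
          rw [h]
          exact (hf t h).1
        · exact hg₁ t (by omega)
      · dsimp only
        rw [if_neg (show T.dist r t ≠ d + 1 by omega)]
        split
        · rename_i h
          exact (hf c h).2 t htc (by omega)
        · exact hg₂ t c htc hc (by omega)
  obtain ⟨g, hg₁, hg₂⟩ := claim D
  refine ⟨g, fun t => ⟨_, hg₁ t (hD t)⟩, fun t c htc v hvt hvc => ?_⟩
  rcases hT.dist_eq_dist_add_one_of_adj r htc with h | h
  · exact (hg₂ c t htc.symm h (hD t) v hvc hvt).symm
  · exact hg₂ t c htc h (hD c) v hvt hvc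

/-- Local colourings of the bags of a tree decomposition that agree along the edges of the tree are
restrictions of one colouring. -/
theorem IsTreeDecomposition.exists_glue {ι V C : Type*} {G : SimpleGraph V} {T : SimpleGraph ι}
    {X : ι → Finset V} (h : IsTreeDecomposition G T X) (g : ι → V → C)
    (hg : ∀ t c, T.Adj t c → ∀ v ∈ X t, v ∈ X c → g t v = g c v) :
    ∃ F : V → C, ∀ t, ∀ v ∈ X t, F v = g t v := by
  choose τ hτ using h.vertex_mem
  refine ⟨fun v => g (τ v) v, fun t v hv => ?_⟩
  have key (x y : {t | v ∈ X t}) (hxy : (T.induce {t | v ∈ X t}).Reachable x y) :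
      g x v = g y v := by
    obtain ⟨p⟩ := hxy
    induction p with
    | nil => rfl
    | @cons x z y hadj p ih => exact (hg x z hadj v x.2 z.2).trans ih
  exact key ⟨τ v, hτ v⟩ ⟨t, hv⟩ ((h.subtree v).preconnected _ _)

/-! ### Correctness of the algorithm -/

open Classical in
/-- A relation, as the list of the rows of its 0-1-matrix. -/
noncomputable def rows {a b : ℕ} (R : Fin a → Fin b → Prop) : List (List Bool) :=
  (List.finRange a).map fun i => (List.finRange b).map fun j => decide (R i j)

theorem ofProp_eq (p : Prop) [Decidable p] : Data.ofProp p = encBool (decide p) := by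
  by_cases h : p <;> simp [Data.ofProp, h]

theorem ofRel_eq {a b : ℕ} (R : Fin a → Fin b → Prop) : Data.ofRel R = encRows (rows R) := by
  classical
  simp [Data.ofRel, encRows, encList, rows, ofProp_eq, Function.comp_def]

@[simp] theorem length_rows {a b : ℕ} (R : Fin a → Fin b → Prop) : (rows R).length = a := by
  simp [rows]

theorem getD_rows {a b : ℕ} (R : Fin a → Fin b → Prop) (i : Fin a) :
    (rows R).getD i [] = (List.finRange b).map fun j => @decide (R i j) (Classical.dec _) := by
  rw [List.getD_eq_getElem _ _ (by simp)]
  simp [rows]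

theorem getD_getD_rows {a b : ℕ} (R : Fin a → Fin b → Prop) (i : Fin a) (j : Fin b) :
    ((rows R).getD i []).getD j false = true ↔ R i j := by
  rw [getD_rows, List.getD_eq_getElem _ _ (by simp)]
  simp

/-- The bit vector of the set `{i}`. -/
def unit (i : ℕ) : List Bool := List.replicate i false ++ [true]

theorem getD_unit (i j : ℕ) : (unit i).getD j false = true ↔ j = i := by
  induction i generalizing j with
  | zero => cases j <;> simp [unit]
  | succ i ih =>
    have : unit (i + 1) = false :: unit i := rfl
    cases j with
    | zero => simp [this]
    | succ j => rw [this, List.getD_cons_succ, ih]; omega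

theorem replicate_append_cons_false (i : ℕ) (a : List Bool) :
    List.replicate i false ++ false :: a = List.replicate (i + 1) false ++ a := by
  rw [List.replicate_succ', List.append_assoc]
  rfl

theorem loopB_eq_true_iff (a : List Bool) (G T X cnt : List (List Bool)) (b : List Bool) :
    loopB a G T X cnt b = true ↔ ∃ i < cnt.length,
      (iter X T T (X.map fun x => gen x G a (List.replicate i false ++ b))).getD 0 [] ≠ [] := by
  induction cnt generalizing b with
  | nil => simp [loopB]
  | cons c cnt ih =>
    have hstep : loopB a G T X (c :: cnt) b = true ↔
        (iter X T T (X.map fun x => gen x G a b)).getD 0 [] ≠ [] ∨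
          loopB a G T X cnt (false :: b) = true := by
      rw [loopB]
      rcases iter X T T (X.map fun x => gen x G a b) with _ | ⟨_ | ⟨w, L⟩, tabs⟩ <;> simp
    rw [hstep, ih]
    simp only [replicate_append_cons_false, List.length_cons]
    constructor
    · rintro (h | ⟨i, hi, h⟩)
      · exact ⟨0, by omega, h⟩
      · exact ⟨i + 1, by omega, h⟩
    · rintro ⟨_ | i, hi, h⟩
      · exact .inl h
      · exact .inr ⟨i, by omega, h⟩

theorem loopA_eq_true_iff (G T X cnt : List (List Bool)) (a : List Bool) :
    loopA G T X cnt a = true ↔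
      ∃ i < cnt.length, loopB (List.replicate i false ++ a) G T X G [true] = true := by
  induction cnt generalizing a with
  | nil => simp [loopA]
  | cons c cnt ih =>
    have hstep : loopA G T X (c :: cnt) a = true ↔
        loopB a G T X G [true] = true ∨ loopA G T X cnt (false :: a) = true := by
      rw [loopA]
      cases loopB a G T X G [true] <;> simp
    rw [hstep, ih]
    simp only [replicate_append_cons_false, List.length_cons]
    constructor
    · rintro (h | ⟨i, hi, h⟩)
      · exact ⟨0, by omega, h⟩
      · exact ⟨i + 1, by omega, h⟩
    · rintro ⟨_ | i, hi, h⟩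
      · exact .inl h
      · exact .inr ⟨i, by omega, h⟩

/-- The colouring of the vertices that is given by a word. -/
def toFun {n : ℕ} (w : List Col) (v : Fin n) : Col := w.getD v .s

/-- The proper colourings of the vertices in `Y`, extended by `s`. -/
structure IsPartialColoring {V : Type*} (G : SimpleGraph V) (Y : Set V) (f : V → Col) :
    Prop where
  outside : ∀ v ∉ Y, f v = .s
  proper : ∀ u ∈ Y, ∀ v ∈ Y, G.Adj u v → conflict (f u) (f v) = false

/-- For an adjacency matrix the condition on pairs `i < j` suffices, as conflict is symmetric. -/
theorem isColoring_iff {n : ℕ} (G : SimpleGraph (Fin n)) (Y : Set (Fin n)) {x : List Bool}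
    (hx : x.length = n) (hY : ∀ v : Fin n, x.getD v false = true ↔ v ∈ Y) (a b : List Bool)
    {w : List Col} : IsColoring x (rows G.Adj) a b w ↔ w.length = n ∧
      IsPartialColoring G Y (toFun w) ∧ ∀ v ∈ Y,
        (a.getD v false = true → toFun w v = .a) ∧ (b.getD v false = true → toFun w v = .b) := by
  constructor
  · rintro ⟨h₁, h₂, h₃, h₄, h₅⟩
    rw [hx] at h₁ h₂ h₃ h₄ h₅
    have key (u v : Fin n) (huv : u < v) (hu : u ∈ Y) (hv : v ∈ Y) (h : G.Adj u v) :
        conflict (toFun w u) (toFun w v) = false :=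
      h₅ u v huv v.2 ((hY u).2 hu) ((hY v).2 hv) ((getD_getD_rows _ u v).2 h)
    refine ⟨h₁, ⟨fun v hv => h₂ v v.2 ?_, fun u hu v hv h => ?_⟩, fun v hv =>
      ⟨h₃ v v.2 ((hY v).2 hv), h₄ v v.2 ((hY v).2 hv)⟩⟩
    · rwa [← hY, Bool.not_eq_true] at hv
    · rcases lt_or_gt_of_ne h.ne with huv | huv
      · exact key u v huv hu hv h
      · rw [conflict_comm]
        exact key v u huv hv hu h.symm
  · rintro ⟨h₁, ⟨h₂, h₃⟩, h₄⟩
    refine ⟨h₁.trans hx.symm, fun v hv h => ?_, fun v hv h => ?_, fun v hv h => ?_,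
      fun u v huv hv h h' h'' => ?_⟩ <;> rw [hx] at hv
    · refine h₂ ⟨v, hv⟩ fun hv' => ?_
      rw [← hY] at hv'
      simp_all
    · exact (h₄ ⟨v, hv⟩ ((hY _).1 h)).1
    · exact (h₄ ⟨v, hv⟩ ((hY _).1 h)).2
    · exact h₃ ⟨u, huv.trans hv⟩ ((hY _).1 h) ⟨v, hv⟩ ((hY _).1 h')
        ((getD_getD_rows G.Adj ⟨u, huv.trans hv⟩ ⟨v, hv⟩).1 h'')

theorem toFun_map {n : ℕ} (F : Fin n → Col) : toFun ((List.finRange n).map F) = F := by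
  funext v
  rw [toFun, List.getD_eq_getElem _ _ (by simp)]
  simp

/-- The first table of the last round is nonempty if and only if there is a proper colouring with
the prescribed letters. -/
theorem iter_ne_nil_iff {n N : ℕ} {G : SimpleGraph (Fin n)} {T : SimpleGraph (Fin N)}
    {X : Fin N → Finset (Fin n)} (h : IsTreeDecomposition G T X) (i j : Fin n) :
    (iter (rows fun t v => v ∈ X t) (rows T.Adj) (rows T.Adj)
      ((rows fun t v => v ∈ X t).map fun x => gen x (rows G.Adj) (unit i) (unit j))).getD 0 [] ≠ []
      ↔ ∃ F, IsProper G F ∧ F i = .a ∧ F j = .b := by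
  classical
  rw [iter_eq_tables, length_rows]
  set XR := rows fun t v => v ∈ X t with hXR
  set TR := rows T.Adj with hTR
  set tabs := XR.map fun x => gen x (rows G.Adj) (unit i) (unit j) with htabs
  obtain ⟨r₀⟩ := h.isTree.connected.nonempty
  have hN : 0 < N := r₀.pos
  let r : Fin N := ⟨0, hN⟩
  have htl : tabs.length = N := by simp [htabs, hXR]
  have hX (t : Fin N) (v : Fin n) : (XR.getD t []).getD v false = true ↔ v ∈ X t :=
    getD_getD_rows _ t v
  have hT (t c : Fin N) : (TR.getD t []).getD c false = true ↔ T.Adj t c :=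
    getD_getD_rows _ t c
  have htab (t : Fin N) (w : List Col) : w ∈ tabs.getD t [] ↔ w.length = n ∧
      IsPartialColoring G (X t) (toFun w) ∧ ∀ v ∈ X t,
        (v = i → toFun w v = .a) ∧ (v = j → toFun w v = .b) := by
    have ht : tabs.getD t [] = gen (XR.getD t []) (rows G.Adj) (unit i) (unit j) := by
      rw [htabs, List.getD_eq_getElem _ _ (by simp [hXR]),
        List.getD_eq_getElem _ _ (by simp [hXR])]
      simp
    rw [ht, mem_gen, isColoring_iff G (X t) (by rw [hXR, getD_rows]; simp) (hX t)]
    simp only [getD_unit, Fin.val_inj, Finset.mem_coe]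
  have hlen : ∀ t, ∀ w ∈ tabs.getD t [], w.length = n := by
    intro t w hw
    by_cases ht : t < N
    · exact ((htab ⟨t, ht⟩ w).1 hw).1
    · rw [List.getD_eq_default _ _ (by omega)] at hw
      simp at hw
  constructor
  · intro hne
    obtain ⟨w₀, hw₀⟩ := List.exists_mem_of_ne_nil _ hne
    let R (k : ℕ) (t : Fin N) : Set (Fin n → Col) :=
      {f | ∃ w ∈ (tables XR TR tabs k).getD t [], toFun w = f}
    obtain ⟨g, hg, hgT⟩ := exists_consistent h.isTree (fun t => (X t : Set (Fin n))) R r N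
      (fun t => by
        obtain ⟨p, hp, hl⟩ := h.isTree.connected.exists_path_of_dist r t
        have := hp.length_lt
        rw [Fintype.card_fin] at this
        omega)
      (by
        rintro k t _ ⟨w, hw, rfl⟩ c htc
        obtain ⟨w', hw', hag⟩ := ((mem_tables_succ hlen k (by omega)).1 hw).2 c (by omega)
          ((hT t c).2 htc)
        exact ⟨_, ⟨w', hw', rfl⟩, fun v hv hv' => hag v ((hX t v).2 hv) ((hX c v).2 hv')⟩)
      ⟨_, w₀, hw₀, rfl⟩
    have hg' (t : Fin N) : IsPartialColoring G (X t) (g t) ∧ ∀ v ∈ X t,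
        (v = i → g t v = .a) ∧ (v = j → g t v = .b) := by
      obtain ⟨k, w, hw, hwg⟩ := hg t
      rw [← hwg]
      exact ((htab t w).1 (mem_tables_zero_of_mem _ _ _ _ _ hw)).2
    obtain ⟨F, hF⟩ := h.exists_glue g hgT
    refine ⟨F, fun u v huv => ?_, ?_, ?_⟩
    · obtain ⟨t, hu, hv⟩ := h.edge_mem u v huv
      rw [hF t u hu, hF t v hv]
      exact (hg' t).1.proper u hu v hv huv
    · obtain ⟨t, ht⟩ := h.vertex_mem i
      rw [hF t i ht]
      exact ((hg' t).2 i ht).1 rfl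
    · obtain ⟨t, ht⟩ := h.vertex_mem j
      rw [hF t j ht]
      exact ((hg' t).2 j ht).2 rfl
  · rintro ⟨F, hF, hi, hj⟩
    -- The restrictions of `F` to the bags survive all rounds.
    let word (t : Fin N) : List Col :=
      (List.finRange n).map fun v => if v ∈ X t then F v else .s
    have hword (t : Fin N) (v : Fin n) (hv : v ∈ X t) : toFun (word t) v = F v := by
      simp only [word]
      rw [toFun_map, if_pos hv]
    have hmem (k : ℕ) (t : Fin N) : word t ∈ (tables XR TR tabs k).getD t [] := by
      induction k generalizing t with
      | zero =>
        refine (htab t _).2 ⟨by simp [word], ⟨fun v hv => ?_, fun u hu v hv huv => ?_⟩,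
          fun v hv => ⟨?_, ?_⟩⟩
        · simp only [word]
          rw [toFun_map, if_neg (by simpa using hv)]
        · rw [hword t u hu, hword t v hv]
          exact hF u v huv
        · rintro rfl
          rw [hword t v hv, hi]
        · rintro rfl
          rw [hword t v hv, hj]
      | succ k ih =>
        refine (mem_tables_succ hlen k (by omega)).2 ⟨ih t, fun c hc _ => ?_⟩
        rw [htl] at hc
        refine ⟨word ⟨c, hc⟩, ih ⟨c, hc⟩, fun v hv hv' => ?_⟩
        by_cases hvn : v < n
        · have h₁ := (hX t ⟨v, hvn⟩).1 hv
          have h₂ := (hX ⟨c, hc⟩ ⟨v, hvn⟩).1 hv'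
          exact (hword t _ h₁).trans (hword _ _ h₂).symm
        · rw [List.getD_eq_default _ _ (by simp [word]; omega),
            List.getD_eq_default _ _ (by simp [word]; omega)]
    exact List.ne_nil_of_mem (hmem N r)

theorem loopA_eq_true_iff_hasIndependentCutset {n N : ℕ} {G : SimpleGraph (Fin n)}
    {T : SimpleGraph (Fin N)} {X : Fin N → Finset (Fin n)} (h : IsTreeDecomposition G T X) :
    loopA (rows G.Adj) (rows T.Adj) (rows fun t v => v ∈ X t) (rows G.Adj) [true] = true ↔
      HasIndependentCutset G := by
  rw [hasIndependentCutset_iff, loopA_eq_true_iff]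
  simp only [loopB_eq_true_iff, length_rows]
  constructor
  · rintro ⟨i, hi, j, hj, hij⟩
    obtain ⟨F, hF, hFi, hFj⟩ := (iter_ne_nil_iff h ⟨i, hi⟩ ⟨j, hj⟩).1 hij
    exact ⟨F, hF, ⟨_, hFi⟩, ⟨_, hFj⟩⟩
  · rintro ⟨F, hF, ⟨i, hi⟩, j, hj⟩
    exact ⟨i, i.2, j, j.2, (iter_ne_nil_iff h i j).2 ⟨F, hF, hi, hj⟩⟩

/-! ### Counting partial colourings -/

/-- The number of vertex sets with at most `k` elements. -/
theorem card_filter_card_le {V : Type*} [Fintype V] [DecidableEq V] [Nonempty V] (k : ℕ) :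
    (Finset.univ.filter fun s : Finset V => s.card ≤ k).card ≤
      (Fintype.card V + 1) * Fintype.card V ^ k := by
  have hsub : (Finset.univ.filter fun s : Finset V => s.card ≤ k) ⊆
      (Finset.range (Fintype.card V + 1)).biUnion fun i =>
        if i ≤ k then Finset.powersetCard i Finset.univ else ∅ := by
    intro s hs
    rw [Finset.mem_filter] at hs
    refine Finset.mem_biUnion.2 ⟨s.card, ?_, ?_⟩
    · simpa [Nat.lt_succ_iff] using s.card_le_univ
    · simp [hs.2]
  refine (Finset.card_le_card hsub).trans ((Finset.card_biUnion_le_card_mul _ _ _ ?_).trans_eq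
    (by rw [Finset.card_range]))
  intro i _
  split
  · rename_i h
    rw [Finset.card_powersetCard, Finset.card_univ]
    exact (Nat.choose_le_pow _ _).trans (Nat.pow_le_pow_right Fintype.card_pos h)
  · simp

/-- The components of a graph are at most as many as the vertices in an independent set, since
representatives of the components are independent. -/
theorem card_connectedComponent_le {V : Type*} [Fintype V] (G : SimpleGraph V) (W : Finset V)
    (k : ℕ) (h : ∀ s ⊆ W, G.IsIndepSet (s : Set V) → s.card ≤ k) :
    Nat.card (G.induce (W : Set V)).ConnectedComponent ≤ k := by
  classical
  rw [Nat.card_eq_fintype_card]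
  have hinj : Function.Injective
      fun c : (G.induce (W : Set V)).ConnectedComponent => (c.out : V) := by
    intro c d hcd
    rw [← Quot.out_eq c, ← Quot.out_eq d, Subtype.ext hcd]
  rw [← Finset.card_univ, ← Finset.card_image_of_injective _ hinj]
  refine h _ ?_ ?_
  · intro v hv
    obtain ⟨c, -, rfl⟩ := Finset.mem_image.1 hv
    exact c.out.2
  · intro u hu v hv huv hadj
    rw [Finset.mem_coe, Finset.mem_image] at hu hv
    obtain ⟨c, -, rfl⟩ := hu
    obtain ⟨d, -, rfl⟩ := hv
    refine huv ?_
    have : (G.induce (W : Set V)).Adj c.out d.out := hadj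
    have hcd : (G.induce (W : Set V)).connectedComponentMk c.out =
        (G.induce (W : Set V)).connectedComponentMk d.out :=
      SimpleGraph.ConnectedComponent.sound this.reachable
    have hc : (G.induce (W : Set V)).connectedComponentMk c.out = c := Quot.out_eq c
    have hd : (G.induce (W : Set V)).connectedComponentMk d.out = d := Quot.out_eq d
    rw [hc, hd] at hcd
    rw [hcd]

instance : Fintype Col := ⟨{.s, .a, .b}, fun c => by cases c <;> simp⟩

theorem eq_of_conflict_eq_false {c d : Col} (hc : c ≠ .s) (hd : d ≠ .s)
    (h : conflict c d = false) : c = d := by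
  cases c <;> cases d <;> simp_all [conflict]

theorem eq_of_eq_a_iff {c d : Col} (hc : c ≠ .s) (hd : d ≠ .s) (h : c = .a ↔ d = .a) : c = d := by
  cases c <;> cases d <;> simp_all

theorem card_col : Fintype.card Col = 3 := rfl

open Classical in
/-- A colouring of `Y` is determined by its restriction to `U`, the set of the vertices of `Y \ U`
with the colour `s`, which is independent, and the colours of the components of the rest of
`Y \ U`. -/
theorem card_isPartialColoring_le {V : Type*} [Fintype V] [DecidableEq V] [Nonempty V]
    (G : SimpleGraph V) (Y U : Finset V) (l k : ℕ) (hU : U.card ≤ l)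
    (hk : ∀ s ⊆ Y \ U, G.IsIndepSet (s : Set V) → s.card ≤ k) :
    (Finset.univ.filter fun f : V → Col => IsPartialColoring G Y f).card ≤
      (Fintype.card V + 1) * (3 ^ l * (2 * Fintype.card V) ^ k) := by
  let S (f : V → Col) : Finset V := (Y \ U).filter fun v => f v = .s
  let φ (f : V → Col) : (U → Col) × Finset V := (fun u => f u, S f)
  set A := Finset.univ.filter fun f : V → Col => IsPartialColoring G Y f with hA
  have himage : (A.image φ).card ≤ 3 ^ l * ((Fintype.card V + 1) * Fintype.card V ^ k) := by
    have hsub : A.image φ ⊆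
        Finset.univ ×ˢ Finset.univ.filter fun s : Finset V => s.card ≤ k := by
      intro p hp
      obtain ⟨f, hf, rfl⟩ := Finset.mem_image.1 hp
      have hf' : IsPartialColoring G Y f := (Finset.mem_filter.1 hf).2
      refine Finset.mem_product.2 ⟨Finset.mem_univ _,
        Finset.mem_filter.2 ⟨Finset.mem_univ _, hk _ (Finset.filter_subset _ _) ?_⟩⟩
      intro u hu v hv _ huv
      have hu' := Finset.mem_filter.1 (Finset.mem_coe.1 hu)
      have hv' := Finset.mem_filter.1 (Finset.mem_coe.1 hv)
      have := hf'.proper u (Finset.mem_sdiff.1 hu'.1).1 v (Finset.mem_sdiff.1 hv'.1).1 huv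
      rw [hu'.2, hv'.2] at this
      cases this
    refine (Finset.card_le_card hsub).trans ?_
    rw [Finset.card_product]
    refine Nat.mul_le_mul ?_ (card_filter_card_le k)
    rw [Finset.card_univ, Fintype.card_fun, card_col, Fintype.card_coe]
    exact Nat.pow_le_pow_right (by norm_num) hU
  have hfiber : ∀ p ∈ A.image φ, (A.filter fun f => φ f = p).card ≤ 2 ^ k := by
    intro p hp
    obtain ⟨f₀, -, rfl⟩ := Finset.mem_image.1 hp
    -- On `W` only the colours `a` and `b` occur, and they are constant on components.
    let W : Finset V := (Y \ U) \ S f₀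
    have hcc := card_connectedComponent_le G W k fun s hs => hk s (hs.trans Finset.sdiff_subset)
    rw [Nat.card_eq_fintype_card] at hcc
    refine le_trans ?_ (Nat.pow_le_pow_right (by norm_num : 0 < 2) hcc)
    let ψ (f : V → Col) (c : (G.induce (W : Set V)).ConnectedComponent) : Bool :=
      decide (f c.out = .a)
    have hfib (f : V → Col) (hf : f ∈ A.filter fun f => φ f = φ f₀) :
        IsPartialColoring G Y f ∧ (∀ u ∈ U, f u = f₀ u) ∧ S f = S f₀ := by
      obtain ⟨hf, hφ⟩ := Finset.mem_filter.1 hf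
      exact ⟨(Finset.mem_filter.1 hf).2, fun u hu => congrFun (congrArg Prod.fst hφ) ⟨u, hu⟩,
        congrArg Prod.snd hφ⟩
    have hWne (f : V → Col) (hS : S f = S f₀) (v : V) (hv : v ∈ W) : f v ≠ .s := by
      intro h
      obtain ⟨hv₁, hv₂⟩ := Finset.mem_sdiff.1 hv
      exact hv₂ (hS ▸ Finset.mem_filter.2 ⟨hv₁, h⟩)
    have hconst (f : V → Col) (hf : IsPartialColoring G Y f) (hS : S f = S f₀)
        (x y : (W : Set V)) (hxy : (G.induce (W : Set V)).Reachable x y) : f x = f y := by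
      obtain ⟨p⟩ := hxy
      induction p with
      | nil => rfl
      | @cons x z y hadj p ih =>
        rw [← ih]
        have hY (v : (W : Set V)) : (v : V) ∈ Y :=
          (Finset.mem_sdiff.1 (Finset.mem_sdiff.1 (Finset.mem_coe.1 v.2)).1).1
        exact eq_of_conflict_eq_false (hWne f hS x x.2) (hWne f hS z z.2)
          (hf.proper x (hY x) z (hY z) hadj)
    have hinj : Set.InjOn ψ (A.filter fun f => φ f = φ f₀) := by
      intro f hf g hg hfg
      obtain ⟨hf₁, hf₂, hf₃⟩ := hfib f hf
      obtain ⟨hg₁, hg₂, hg₃⟩ := hfib g hg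
      funext v
      by_cases hvU : v ∈ U
      · rw [hf₂ v hvU, hg₂ v hvU]
      by_cases hvY : v ∈ Y
      · by_cases hvS : v ∈ S f₀
        · have hvf : v ∈ S f := hf₃ ▸ hvS
          have hvg : v ∈ S g := hg₃ ▸ hvS
          rw [(Finset.mem_filter.1 hvf).2, (Finset.mem_filter.1 hvg).2]
        · have hvW : v ∈ W := by simp [W, hvU, hvY, hvS]
          let c := (G.induce (W : Set V)).connectedComponentMk ⟨v, hvW⟩
          have hc : (G.induce (W : Set V)).Reachable ⟨v, hvW⟩ c.out :=
            SimpleGraph.ConnectedComponent.exact (Quot.out_eq c).symm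
          have e₁ := hconst f hf₁ hf₃ _ _ hc
          have e₂ := hconst g hg₁ hg₃ _ _ hc
          have e₃ := congrFun hfg c
          simp only [ψ, decide_eq_decide] at e₃
          rw [← e₁, ← e₂] at e₃
          exact eq_of_eq_a_iff (hWne f hf₃ v hvW) (hWne g hg₃ v hvW) e₃
      · rw [hf₁.outside v hvY, hg₁.outside v hvY]
    calc _ ≤ (Finset.univ : Finset ((G.induce (W : Set V)).ConnectedComponent → Bool)).card :=
          Finset.card_le_card_of_injOn ψ (fun _ _ => Finset.mem_coe.2 (Finset.mem_univ _)) hinj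
      _ = _ := by
        rw [Finset.card_univ, Fintype.card_fun, Fintype.card_bool]
  calc A.card ≤ 2 ^ k * (A.image φ).card := Finset.card_le_mul_card_image _ _ hfiber
    _ ≤ 2 ^ k * (3 ^ l * ((Fintype.card V + 1) * Fintype.card V ^ k)) :=
        Nat.mul_le_mul_left _ himage
    _ = _ := by rw [mul_pow]; ring

theorem toFun_injOn {n : ℕ} : Set.InjOn (toFun (n := n)) {w | w.length = n} := by
  intro w hw w' hw' h
  refine List.ext_getElem (hw.trans hw'.symm) fun i hi hi' => ?_
  have := congrFun h ⟨i, hi.trans_eq hw⟩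
  simpa [toFun, hi, hi'] using this

/-- The bit vector `x` may describe any subset of the bag `X`, as the independence number of
`G[X \ U]` bounds that of its induced subgraphs. -/
theorem length_gen_le {n : ℕ} (hn : 0 < n) (G : SimpleGraph (Fin n)) (X U : Finset (Fin n))
    (l k : ℕ) (hU : U.card ≤ l)
    (hk : ∀ s ⊆ X \ U, G.IsIndepSet (s : Set (Fin n)) → s.card ≤ k)
    {x : List Bool} (hx : x.length = n) (hX : ∀ v : Fin n, x.getD v false = true → v ∈ X)
    (a b : List Bool) :
    (gen x (rows G.Adj) a b).length ≤ (n + 1) * (3 ^ l * (2 * n) ^ k) := by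
  classical
  have : Nonempty (Fin n) := ⟨⟨0, hn⟩⟩
  set Y : Finset (Fin n) := Finset.univ.filter fun v => x.getD v false = true with hY
  have hYX : Y ⊆ X := fun v hv => hX v (Finset.mem_filter.1 hv).2
  have hY' (v : Fin n) : x.getD v false = true ↔ v ∈ (Y : Set (Fin n)) := by simp [hY]
  have hcount := card_isPartialColoring_le G Y U l k hU fun s hs =>
    hk s (hs.trans (Finset.sdiff_subset_sdiff hYX (Finset.Subset.refl _)))
  rw [Fintype.card_fin] at hcount
  refine le_trans ?_ hcount
  rw [← List.toFinset_card_of_nodup (nodup_gen _ _ _ _)]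
  have hmem (w : List Col) (hw : w ∈ (gen x (rows G.Adj) a b).toFinset) :=
    (isColoring_iff G Y hx hY' a b).1 (mem_gen.1 (List.mem_toFinset.1 hw))
  refine Finset.card_le_card_of_injOn toFun (fun w hw => ?_) fun w hw w' hw' h =>
    toFun_injOn (hmem w hw).1 (hmem w' hw').1 h
  exact Finset.mem_coe.2 (Finset.mem_filter.2 ⟨Finset.mem_univ _, (hmem w hw).2.1⟩)

theorem card_le_of_residualIndepNum_le {V ι : Type*} [Finite V] [DecidableEq V] [Fintype ι]
    {G : SimpleGraph V} {X U : ι → Finset V} {k : ℕ} (h : residualIndepNum G X U ≤ k) (t : ι)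
    (s : Finset V) (hs : s ⊆ X t \ U t) (hi : G.IsIndepSet (s : Set V)) : s.card ≤ k := by
  classical
  refine le_trans ?_ ((Finset.le_sup (f := fun t =>
    (G.induce (↑(X t \ U t) : Set V)).indepNum) (Finset.mem_univ t)).trans h)
  have hcard : (s.subtype (· ∈ (↑(X t \ U t) : Set V))).card = s.card := by
    rw [Finset.card_subtype, Finset.filter_true_of_mem]
    exact fun v hv => Finset.mem_coe.2 (hs hv)
  rw [← hcard]
  refine SimpleGraph.IsIndepSet.card_le_indepNum ?_
  intro u hu v hv huv hadj
  exact hi (by simpa using hu) (by simpa using hv) (fun e => huv (Subtype.ext e)) hadj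

/-! ### The bound for the whole program -/

theorem encodeInput_eq {n N : ℕ} (G : SimpleGraph (Fin n)) (T : SimpleGraph (Fin N))
    (r : Fin N) (X U : Fin N → Finset (Fin n)) :
    encodeInput G T r X U = .ofList [encRows (rows G.Adj), encRows (rows T.Adj), .ofNat r,
      encRows (rows fun t v => v ∈ X t), encRows (rows fun t v => v ∈ U t)] := by
  simp only [encodeInput, ofRel_eq]

theorem pairCost_le {n N Z : ℕ} (hZ : 0 < Z) :
    (n + 2) * ((n + 2) * pairCost n N ((n + 1) * Z)) ≤ 3000 * (n + N + 2) ^ 7 * Z := by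
  have h : (n + 1) * Z + 1 ≤ (n + N + 2) * Z := by nlinarith
  calc (n + 2) * ((n + 2) * pairCost n N ((n + 1) * Z))
      ≤ (n + N + 2) * ((n + N + 2) * (3000 * ((n + N + 2) * ((n + N + 2) * ((n + N + 2) *
          (((n + N + 2) * Z) * (n + N + 2))))))) := by
        unfold pairCost
        gcongr <;> omega
    _ = 3000 * (n + N + 2) ^ 7 * Z := by ring

end IndCut

theorem mainTheorem8 :
    ∃ (P : IndCut.Program) (p : Polynomial ℕ),
      ∀ (n N : ℕ) (G : SimpleGraph (Fin n)) (T : SimpleGraph (Fin N)) (r : Fin N)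
        (X U : Fin N → Finset (Fin n)) (l k : ℕ),
        G.Connected →
        IndCut.IsRefinedTreeDecomposition G T X U l →
        IndCut.IsNice T r X →
        IndCut.residualIndepNum G X U ≤ k →
        ∃ s : ℕ, s ≤ p.eval (n + N) * (3 ^ l * (2 * n) ^ k) ∧
          P.Returns (IndCut.encodeInput G T r X U)
            (IndCut.Data.ofProp (IndCut.HasIndependentCutset G)) s := by
  classical
  refine ⟨IndCut.prog, 3000 * (Polynomial.X + 2) ^ 7, ?_⟩
  intro n N G T r X U l k hG hR _ hk
  have hn : 0 < n := by
    obtain ⟨v⟩ := hG.nonempty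
    exact v.pos
  set Z := 3 ^ l * (2 * n) ^ k with hZ
  have hZ₀ : 0 < Z := by positivity
  obtain ⟨s, hs, body, hbody, h⟩ := IndCut.runs_prog (n := n) (N := N) (K := (n + 1) * Z)
    (IndCut.rows G.Adj) (IndCut.rows T.Adj) (IndCut.rows fun t v => v ∈ X t) (.ofNat r)
    (IndCut.encRows (IndCut.rows fun t v => v ∈ U t))
    (by simp [IndCut.rows]) (by simp) (by simp) (by simp)
    (by
      intro a b x hx i hi
      obtain ⟨t, -, rfl⟩ := List.mem_map.1 hx
      rw [List.length_map, List.length_finRange] at hi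
      refine IndCut.length_gen_le hn G (X t) (U t) l k (hR.card_le t)
        (IndCut.card_le_of_residualIndepNum_le hk t) (by simp; omega) (fun v hv => ?_) a b
      rw [List.getD_eq_getElem?_getD, List.getElem?_append] at hv
      by_cases hvi : (v : ℕ) < i
      · simp [hvi] at hv
      · simp [hvi] at hv
        simpa [show i + ((v : ℕ) - i) = v by omega] using hv)
  refine ⟨s, ?_, body, hbody, ?_⟩
  · refine hs.trans ((IndCut.pairCost_le hZ₀).trans_eq ?_)
    simp
  · rw [IndCut.encodeInput_eq, IndCut.ofProp_eq]
    convert h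
    rw [Bool.eq_iff_iff, decide_eq_true_iff]
    exact (IndCut.loopA_eq_true_iff_hasIndependentCutset hR.treeDecomposition).symm
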